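/- An oriented virtual knot diagram $K$ is described by its signed Gauss code: the cyclic word of passages met while traversing the knot once, where $O_c$, $U_c$ denote the over- and underpass of the classical crossing $c$ and $V_v$ (occurring twice) a passage through the virtual crossing $v$, together with a sign $\pm1$ for each classical crossing. Its bracket polynomial is $$\langle K\rangle=\sum_{s}A^{c(s)}d^{\,|s|-1}\in\mathbb Z[A,A^{-1}],\qquad d=-A^{2}-A^{-2},$$ where $s$ runs over the states, i.e. the choices of an $\alpha$- or $\beta$-smoothing at each classical crossing (the $\alpha$-smoothing is the orientation-respecting one at a positive crossing and the other one at a negative crossing), $c(s)$ is the number of $\alpha$- minus the number of $\beta$-smoothings, and $|s|$ is the number of closed curves of $s$ (curves run straight through virtual crossings). The writhe $w(K)$ is the sum of the signs of the classical crossings. The fundamental group $\pi_1(K)$ is given by the Wirtinger presentation: generators are the arcs of the diagram between classical crossings (passing through virtual crossings), the two overcrossing arcs $o$ at a crossing of sign $\varepsilon$ are identified, and the incoming and outgoing undercrossing arcs $u,u'$ satisfy $u'=o^{-\varepsilon}u\,o^{\varepsilon}$. For $t\in\mathbb Z$ put $n=|t|$ and let $K_m(t)$ be the virtual knot diagram with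 classical crossings $0,1,\dots,5+n$, virtual crossings $0,1$ and Gauss code $$U_0\,O_3\,V_0\;\;X_6X_7\cdots X_{5+n}\;\;L_n\;\;\overline X_{5+n}\cdots \overline X_7\overline X_6\;\;V_0\,O_2\,U_1\;\;U_4\,V_1\,O_5\,O_4\,V_1\,U_5 .$$ Here $X_6,X_7,\dots$ are alternately over- and underpasses, beginning with an overpass if $t>0$ and with an underpass if $t<0$; $\overline X_k$ is the other passage of crossing $k$; and $L_n=O_0O_1U_2U_3$ if $n$ is even, $L_n=U_3U_2O_1O_0$ if $n$ is odd. The crossings $6,\dots,5+n$ (the $n$ inserted half twists) have the sign of $t$; crossings $0,3$ have sign $(-1)^n$ and crossings $1,2$ sign $-(-1)^n$; crossing $4$ is negative and crossing $5$ is positive. **Theorem.** For every $t\in\mathbb Z$, $$\langle K_m(t)\rangle=(-A)^{3t}=(-1)^tA^{3t},$$ so that the normalized bracket polynomial satisfies $(-A^{3})^{-w(K_m(t))}\langle K_m(t)\rangle=1$, the value for the unknot; and $\pi_1(K_m(t))\cong\mathbb Z$, the fundamental group of the unknot. -/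

import Mathlib

open LaurentPolynomial

/-- One passage of the knot through a crossing: over or under the classical crossing with label `c`,
or through the virtual crossing with label `v`. -/
inductive Passage where
  | over (c : ℕ)
  | under (c : ℕ)
  | virt (v : ℕ)
  deriving DecidableEq

/-- An oriented virtual knot diagram, given by its signed Gauss code.  Starting from a base point
that is not a crossing, `word` lists the passages met while the knot is traversed once along its
orientation.  Every classical crossing is passed once over and once under, every virtual crossing
is passed twice.  `sign c` is the sign of the classical crossing `c` (its value at a label that
does not occur is irrelevant). -/
structure VirtualKnotDiagram where
  word : List Passage
  sign : ℕ → ℤˣ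
  over_count : ∀ c, word.count (Passage.over c) ≤ 1
  under_count : ∀ c, word.count (Passage.under c) = word.count (Passage.over c)
  virt_count : ∀ v, word.count (Passage.virt v) = 0 ∨ word.count (Passage.virt v) = 2

namespace VirtualKnotDiagram

/-- The passages, numbered along the knot. -/
abbrev Pos (K : VirtualKnotDiagram) : Type := Fin K.word.length

/-- The edges of the diagram cut at its base point.  Passage `i` leads from the edge `i.castSucc`
to the edge `i.succ`; the first edge `0` and the last edge `Fin.last _` meet at the base point. -/
abbrev Edge (K : VirtualKnotDiagram) : Type := Fin (K.word.length + 1)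

/-- The classical crossings. -/
def crossings (K : VirtualKnotDiagram) : Finset ℕ :=
  (K.word.filterMap fun
    | Passage.over c => some c
    | _ => none).toFinset

/-- How the ends of the edges are joined in the state in which the classical crossings in `S` have
a type `α` smoothing and the others a type `β` smoothing.  At a positive crossing the type `α`
smoothing respects the orientation and the type `β` smoothing does not; at a negative crossing it
is the other way round. -/
inductive Joined (K : VirtualKnotDiagram) (S : Finset ℕ) : K.Edge → K.Edge → Prop
  | base : Joined K S (Fin.last _) 0
  | virt (i : K.Pos) (v : ℕ) (hi : K.word.get i = Passage.virt v) :
      Joined K S i.castSucc i.succ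
  | oriented_over (c : ℕ) (i j : K.Pos) (hi : K.word.get i = Passage.over c)
      (hj : K.word.get j = Passage.under c) (h : c ∈ S ↔ K.sign c = 1) :
      Joined K S i.castSucc j.succ
  | oriented_under (c : ℕ) (i j : K.Pos) (hi : K.word.get i = Passage.over c)
      (hj : K.word.get j = Passage.under c) (h : c ∈ S ↔ K.sign c = 1) :
      Joined K S j.castSucc i.succ
  | unoriented_in (c : ℕ) (i j : K.Pos) (hi : K.word.get i = Passage.over c)
      (hj : K.word.get j = Passage.under c) (h : ¬(c ∈ S ↔ K.sign c = 1)) :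
      Joined K S i.castSucc j.castSucc
  | unoriented_out (c : ℕ) (i j : K.Pos) (hi : K.word.get i = Passage.over c)
      (hj : K.word.get j = Passage.under c) (h : ¬(c ∈ S ↔ K.sign c = 1)) :
      Joined K S i.succ j.succ

/-- The number `|s|` of closed curves of a state: the classes of edges under the equivalence
relation generated by `Joined`. -/
noncomputable def curves (K : VirtualKnotDiagram) (S : Finset ℕ) : ℕ :=
  Nat.card (Quot (K.Joined S))

/-- The bracket polynomial `∑ A ^ c(s) * d ^ (|s| - 1)` with `d = -A⁻² - A²`; here `A` is the
variable `T 1`, and `c(s)` is the number of type `α` minus the number of type `β` smoothings. -/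
noncomputable def bracket (K : VirtualKnotDiagram) : ℤ[T;T⁻¹] :=
  ∑ S ∈ K.crossings.powerset,
    T ((S.card : ℤ) - ((K.crossings \ S).card : ℤ)) * (-T (-2) - T 2) ^ (K.curves S - 1)

/-- The writhe: the sum of the signs of the classical crossings. -/
def writhe (K : VirtualKnotDiagram) : ℤ :=
  ∑ c ∈ K.crossings, (K.sign c : ℤ)

/-- The normalized bracket polynomial `(-A³) ^ (-w) ⟨K⟩`, where `w` is the writhe. -/
noncomputable def normalizedBracket (K : VirtualKnotDiagram) : ℤ[T;T⁻¹] :=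
  C ((Int.negOnePow K.writhe : ℤˣ) : ℤ) * T (-3 * K.writhe) * K.bracket

/-- The relators of the fundamental group.  A label does not change at the base point, at a virtual
crossing and along an overpass; at an underpass it is conjugated by the label of the overpass. -/
inductive IsRelator (K : VirtualKnotDiagram) : FreeGroup K.Edge → Prop
  | base : IsRelator K (FreeGroup.of (Fin.last _) * (FreeGroup.of 0)⁻¹)
  | virt (i : K.Pos) (v : ℕ) (hi : K.word.get i = Passage.virt v) :
      IsRelator K (FreeGroup.of i.succ * (FreeGroup.of i.castSucc)⁻¹)
  | over (i : K.Pos) (c : ℕ) (hi : K.word.get i = Passage.over c) :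
      IsRelator K (FreeGroup.of i.succ * (FreeGroup.of i.castSucc)⁻¹)
  | under (c : ℕ) (i j : K.Pos) (hi : K.word.get i = Passage.over c)
      (hj : K.word.get j = Passage.under c) :
      IsRelator K (FreeGroup.of j.succ *
        (FreeGroup.of i.castSucc ^ (-(K.sign c : ℤ)) * FreeGroup.of j.castSucc *
          FreeGroup.of i.castSucc ^ (K.sign c : ℤ))⁻¹)

/-- The fundamental group of a virtual knot diagram (Wirtinger presentation). -/
abbrev fundamentalGroup (K : VirtualKnotDiagram) : Type :=
  PresentedGroup {r | K.IsRelator r}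

end VirtualKnotDiagram

/-- Two antiparallel strands are twisted around each other with the `n` crossings
`6, 7, …, 5 + n`: the passages of the strand that meets them in this order, alternately over and
under, starting over if `b` and under otherwise. -/
def twistForth (b : Bool) (n : ℕ) : List Passage :=
  (List.range n).map fun k =>
    if Even k ↔ b = true then Passage.over (6 + k) else Passage.under (6 + k)

/-- The passages of the other strand, which meets the same crossings in the opposite order. -/
def twistBack (b : Bool) (n : ℕ) : List Passage :=
  ((List.range n).map fun k =>
    if Even k ↔ b = true then Passage.under (6 + k) else Passage.over (6 + k)).reverse

/-- The end loop of the twisted band; an odd number of half twists reverses its direction. -/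
def endLoop (n : ℕ) : List Passage :=
  if Even n then [Passage.over 0, Passage.over 1, Passage.under 2, Passage.under 3]
  else [Passage.under 3, Passage.under 2, Passage.over 1, Passage.over 0]

/-- The Gauss word of `K_m(t)`, where `n = |t|`, and `b` says whether `0 < t`.  The last line is
the left half (half of Kishino's knot: classical crossings `4`, `5` and virtual crossing `1`), the
rest is the right half: a band of two antiparallel strands that crosses itself in the virtual
crossing `0`, runs through `n` half twists, and ends in a loop around the band (classical
crossings `0, 1, 2, 3`). -/
def kmWord (b : Bool) (n : ℕ) : List Passage :=
  [Passage.under 0, Passage.over 3, Passage.virt 0] ++ twistForth b n ++ endLoop n ++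
    twistBack b n ++ [Passage.virt 0, Passage.over 2, Passage.under 1] ++
    [Passage.under 4, Passage.virt 1, Passage.over 5, Passage.over 4, Passage.virt 1,
      Passage.under 5]

/-- The signs of the crossings of `K_m(t)`. -/
def kmSign (b : Bool) (n : ℕ) : ℕ → ℤˣ
  | 0 => if Even n then 1 else -1
  | 1 => if Even n then -1 else 1
  | 2 => if Even n then -1 else 1
  | 3 => if Even n then 1 else -1
  | 4 => -1
  | 5 => 1
  | _ => if b then 1 else -1

theorem twist_count_over (b : Bool) (n c : ℕ) :
    (twistForth b n).count (Passage.over c) + (twistBack b n).count (Passage.over c) =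
      if 6 ≤ c ∧ c < 6 + n then 1 else 0 := by
  simp only [twistForth, twistBack, List.count_reverse]
  induction n with
  | zero => simp
  | succ n ih =>
    simp only [List.range_succ, List.map_append, List.count_append, List.map_cons, List.map_nil]
    by_cases h : (Even n ↔ b = true) <;> by_cases hc : 6 + n = c <;>
      simp [h, hc] <;> split_ifs at ih ⊢ <;> omega

theorem twist_count_under (b : Bool) (n c : ℕ) :
    (twistForth b n).count (Passage.under c) + (twistBack b n).count (Passage.under c) =
      if 6 ≤ c ∧ c < 6 + n then 1 else 0 := by
  simp only [twistForth, twistBack, List.count_reverse]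
  induction n with
  | zero => simp
  | succ n ih =>
    simp only [List.range_succ, List.map_append, List.count_append, List.map_cons, List.map_nil]
    by_cases h : (Even n ↔ b = true) <;> by_cases hc : 6 + n = c <;>
      simp [h, hc] <;> split_ifs at ih ⊢ <;> omega

theorem twist_count_virt (b : Bool) (n v : ℕ) :
    (twistForth b n).count (Passage.virt v) = 0 ∧ (twistBack b n).count (Passage.virt v) = 0 := by
  constructor <;> rw [List.count_eq_zero] <;> simp only [twistForth, twistBack, List.mem_reverse,
    List.mem_map, not_exists, not_and] <;> intro k _ <;> split_ifs <;> simp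

theorem kmWord_count_over (b : Bool) (n c : ℕ) :
    (kmWord b n).count (Passage.over c) = if c < 6 + n then 1 else 0 := by
  have h := twist_count_over b n c
  rcases Nat.lt_or_ge c 6 with hc | hc
  · rw [if_pos (by omega : c < 6 + n)]
    interval_cases c <;> by_cases hn : Even n <;>
      simp [kmWord, endLoop, hn] at h ⊢ <;> omega
  · have e : (endLoop n).count (Passage.over c) = 0 := by
      rw [List.count_eq_zero]; unfold endLoop; split_ifs <;> simp <;> omega
    simp only [kmWord, List.count_append, List.count_cons, List.count_nil, e]
    simp [show ¬ 3 = c by omega, show ¬ 2 = c by omega, show ¬ 5 = c by omega,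
      show ¬ 4 = c by omega, h, hc]

theorem kmWord_count_under (b : Bool) (n c : ℕ) :
    (kmWord b n).count (Passage.under c) = if c < 6 + n then 1 else 0 := by
  have h := twist_count_under b n c
  rcases Nat.lt_or_ge c 6 with hc | hc
  · rw [if_pos (by omega : c < 6 + n)]
    interval_cases c <;> by_cases hn : Even n <;>
      simp [kmWord, endLoop, hn] at h ⊢ <;> omega
  · have e : (endLoop n).count (Passage.under c) = 0 := by
      rw [List.count_eq_zero]; unfold endLoop; split_ifs <;> simp <;> omega
    simp only [kmWord, List.count_append, List.count_cons, List.count_nil, e]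
    simp [show ¬ 0 = c by omega, show ¬ 1 = c by omega, show ¬ 5 = c by omega,
      show ¬ 4 = c by omega, h, hc]

theorem kmWord_count_virt (b : Bool) (n v : ℕ) :
    (kmWord b n).count (Passage.virt v) = if v < 2 then 2 else 0 := by
  have e : (endLoop n).count (Passage.virt v) = 0 := by
    rw [List.count_eq_zero]; unfold endLoop; split_ifs <;> simp
  obtain ⟨h1, h2⟩ := twist_count_virt b n v
  simp only [kmWord, List.count_append, List.count_cons, List.count_nil, e, h1, h2]
  rcases v with _ | _ | v <;> simp

/-- The virtual knot diagram `K_m(t)`, with `|t|` half twists whose crossings have the sign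
of `t`. -/
def Km (t : ℤ) : VirtualKnotDiagram where
  word := kmWord (decide (0 < t)) t.natAbs
  sign := kmSign (decide (0 < t)) t.natAbs
  over_count c := by rw [kmWord_count_over]; split_ifs <;> omega
  under_count c := by rw [kmWord_count_over, kmWord_count_under]
  virt_count v := by rw [kmWord_count_virt]; split_ifs <;> simp

/-! Bracket. The `n` half twists join two antiparallel strands. At a twist crossing the
orientation-respecting smoothing cuts the band and closes it off on both sides; the other smoothing
lets both strands run through, interchanged. Hence a state is a pair of a state `P` of the six core
crossings and the set `J` of twists smoothed along the orientation. If `J` is empty, the curves are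
those of `P` with a straight band; if `|J| = j > 0`, they are those of `P` with a cut band, plus the
`j - 1` circles between consecutive cuts. An odd `n` gives the same core: the end loop is then
reversed, and the flipped signs of crossings `0, …, 3` compensate. The 64 core states add up to `1`
for the straight band and to `d` for the cut band (`core_sum_straight`, `core_sum_cut`). With `ε`
the sign of the twists, the bracket is therefore `∑_J A^{ε(2|J| - n)} d^{|J|} = (A^ε d + A^{-ε})^n =
(-A^{3ε})^n` (`kmDiagram_bracket`). The core signs cancel, so the writhe is `t` and normalization
gives `1`. Curves are counted by `IsStateColoring.curves_eq`: an explicit edge labelling is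
compatible with the state, and the tautological labelling by curves factors through it. Group. All
meridians agree. The left half forces its own arcs to be equal; crossings `0` and `1`, of opposite
signs under one arc, give both strands of the band the same meridian; this passes along the twists
to that very arc, and crossing `0` then identifies it with the base meridian (`meridian_three`). -/

/-! ### State colorings and the number of curves. -/

/-- The labels `f` agree on the edges that are joined at the crossing `c` in the state `S`; the
edges are numbered from `0` along the knot. -/
def VirtualKnotDiagram.CompatibleAt (K : VirtualKnotDiagram) (S : Finset ℕ) {γ : Type*}
    (f : ℕ → γ) (c : ℕ) : Prop :=
  ∀ i j, K.word[i]? = some (Passage.over c) → K.word[j]? = some (Passage.under c) →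
    ((c ∈ S ↔ K.sign c = 1) → f i = f (j + 1) ∧ f j = f (i + 1)) ∧
    (¬(c ∈ S ↔ K.sign c = 1) → f i = f j ∧ f (i + 1) = f (j + 1))

/-- Edge labels that are constant on the curves of the state `S`. -/
def VirtualKnotDiagram.IsStateColoring (K : VirtualKnotDiagram) (S : Finset ℕ) {γ : Type*}
    (f : ℕ → γ) : Prop :=
  f K.word.length = f 0 ∧
  (∀ i v, K.word[i]? = some (Passage.virt v) → f i = f (i + 1)) ∧ ∀ c, K.CompatibleAt S f c

namespace VirtualKnotDiagram

variable {K : VirtualKnotDiagram} {S : Finset ℕ}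

/-- The curve of the state `S` through the edge with number `i`. -/
def curveThrough (K : VirtualKnotDiagram) (S : Finset ℕ) (i : ℕ) : Quot (K.Joined S) :=
  Quot.mk _ (Fin.ofNat _ i)

theorem curveThrough_eq {i : ℕ} (e : K.Edge) (h : e.val = i) :
    K.curveThrough S i = Quot.mk _ e := by
  subst h
  simp [curveThrough]

/-- This is the universal coloring. Applying a characterization of colorings to it shows which edges
lie on a common curve. -/
theorem isStateColoring_curveThrough : K.IsStateColoring S (K.curveThrough S) := by
  refine ⟨?_, fun i v hi => ?_, fun c i j hi hj => ?_⟩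
  · rw [curveThrough_eq (i := K.word.length) (Fin.last _) rfl, curveThrough_eq (i := 0) 0 rfl]
    exact Quot.sound .base
  · obtain ⟨h, hi⟩ := List.getElem?_eq_some_iff.1 hi
    rw [curveThrough_eq (i := i) (Fin.castSucc ⟨i, h⟩) rfl,
      curveThrough_eq (i := i + 1) (Fin.succ ⟨i, h⟩) rfl]
    exact Quot.sound (.virt _ v hi)
  · obtain ⟨h, hi⟩ := List.getElem?_eq_some_iff.1 hi
    obtain ⟨h', hj⟩ := List.getElem?_eq_some_iff.1 hj
    rw [curveThrough_eq (i := i) (Fin.castSucc ⟨i, h⟩) rfl,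
      curveThrough_eq (i := i + 1) (Fin.succ ⟨i, h⟩) rfl,
      curveThrough_eq (i := j) (Fin.castSucc ⟨j, h'⟩) rfl,
      curveThrough_eq (i := j + 1) (Fin.succ ⟨j, h'⟩) rfl]
    exact ⟨fun o => ⟨Quot.sound (.oriented_over c _ _ hi hj o),
        Quot.sound (.oriented_under c _ _ hi hj o)⟩,
      fun o => ⟨Quot.sound (.unoriented_in c _ _ hi hj o),
        Quot.sound (.unoriented_out c _ _ hi hj o)⟩⟩

theorem IsStateColoring.eq_of_joined {γ : Type*} {f : ℕ → γ} (hf : K.IsStateColoring S f)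
    {x y : K.Edge} (h : K.Joined S x y) : f x = f y := by
  obtain ⟨h0, hv, hc⟩ := hf
  have key (i : K.Pos) {p : Passage} (hi : K.word.get i = p) : K.word[i.val]? = some p := by
    rw [← hi]; simp
  cases h with
  | base => simpa using h0
  | virt i v hi => simpa using hv i v (key i hi)
  | oriented_over c i j hi hj h => simpa using ((hc c i j (key i hi) (key j hj)).1 h).1
  | oriented_under c i j hi hj h => simpa using ((hc c i j (key i hi) (key j hj)).1 h).2
  | unoriented_in c i j hi hj h => simpa using ((hc c i j (key i hi) (key j hj)).2 h).1
  | unoriented_out c i j hi hj h => simpa using ((hc c i j (key i hi) (key j hj)).2 h).2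

/-- A coloring that separates the curves of a state counts them. -/
theorem IsStateColoring.curves_eq {γ : Type*} {f : ℕ → γ} (hf : K.IsStateColoring S f)
    (inj : ∀ x ≤ K.word.length, ∀ y ≤ K.word.length, f x = f y →
      K.curveThrough S x = K.curveThrough S y) (s : Finset γ)
    (hs : ∀ c, c ∈ s ↔ ∃ x ≤ K.word.length, f x = c) : K.curves S = s.card := by
  rw [← Nat.card_eq_finsetCard]
  refine Nat.card_eq_of_bijective
    (Quot.lift (fun x : K.Edge => (⟨f x, (hs _).2 ⟨x, Nat.le_of_lt_succ x.2, rfl⟩⟩ : s))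
      fun x y h => Subtype.ext (hf.eq_of_joined h)) ⟨?_, fun ⟨c, hc⟩ => ?_⟩
  · rintro ⟨x⟩ ⟨y⟩ h
    have := inj x (Nat.le_of_lt_succ x.2) y (Nat.le_of_lt_succ y.2) (Subtype.ext_iff.1 h)
    rwa [curveThrough_eq x rfl, curveThrough_eq y rfl] at this
  · obtain ⟨x, hx, rfl⟩ := (hs c).1 hc
    exact ⟨Quot.mk _ ⟨x, Nat.lt_succ_of_le hx⟩, rfl⟩

end VirtualKnotDiagram

/-! ### Positions of the passages in the Gauss word. -/

/-- `K_m(t)` with `t = n` if `b` and `t = -n` otherwise. -/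
def kmDiagram (b : Bool) (n : ℕ) : VirtualKnotDiagram where
  word := kmWord b n
  sign := kmSign b n
  over_count c := by rw [kmWord_count_over]; split_ifs <;> omega
  under_count c := by rw [kmWord_count_over, kmWord_count_under]
  virt_count v := by rw [kmWord_count_virt]; split_ifs <;> simp

theorem length_kmWord (b : Bool) (n : ℕ) : (kmWord b n).length = 16 + 2 * n := by
  have : (endLoop n).length = 4 := by unfold endLoop; split_ifs <;> rfl
  simp [kmWord, twistForth, twistBack, this]; omega

theorem kmWord_getElem?_start (b : Bool) (n i : ℕ) (hi : i < 3) :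
    (kmWord b n)[i]? = [Passage.under 0, Passage.over 3, Passage.virt 0][i]? := by
  simp only [kmWord, List.append_assoc]
  rw [List.getElem?_append_left (by simpa using hi)]

theorem kmWord_getElem?_forth (b : Bool) (n k : ℕ) (hk : k < n) :
    (kmWord b n)[3 + k]? =
      some (if Even k ↔ b = true then Passage.over (6 + k) else Passage.under (6 + k)) := by
  simp only [kmWord, List.append_assoc]
  rw [List.getElem?_append_right (by simp), List.getElem?_append_left (by simp [twistForth, hk])]
  simp [twistForth, hk]

theorem kmWord_getElem?_loop (b : Bool) (n i : ℕ) (hi : i < 4) :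
    (kmWord b n)[3 + n + i]? = (endLoop n)[i]? := by
  have : (endLoop n).length = 4 := by unfold endLoop; split_ifs <;> rfl
  simp only [kmWord, List.append_assoc]
  rw [List.getElem?_append_right (by simp; omega),
    List.getElem?_append_right (by simp [twistForth]; omega),
    List.getElem?_append_left (by simp [twistForth, this]; omega)]
  congr 1
  simp [twistForth]; omega

theorem kmWord_getElem?_back (b : Bool) (n k : ℕ) (hk : k < n) :
    (kmWord b n)[6 + 2 * n - k]? =
      some (if Even k ↔ b = true then Passage.under (6 + k) else Passage.over (6 + k)) := by
  have : (endLoop n).length = 4 := by unfold endLoop; split_ifs <;> rfl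
  simp only [kmWord, List.append_assoc]
  rw [List.getElem?_append_right (by simp; omega),
    List.getElem?_append_right (by simp [twistForth]; omega),
    List.getElem?_append_right (by simp [twistForth, this]; omega),
    List.getElem?_append_left (by simp [twistForth, twistBack, this]; omega)]
  have e : 6 + 2 * n - k - [Passage.under 0, Passage.over 3, Passage.virt 0].length -
      (twistForth b n).length - (endLoop n).length = n - 1 - k := by
    simp [twistForth, this]; omega
  rw [e, twistBack, List.getElem?_reverse (by simp; omega)]
  have e' : n - 1 - (n - 1 - k) = k := by omega
  simp [e', hk]

theorem kmWord_getElem?_finish (b : Bool) (n i : ℕ) :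
    (kmWord b n)[7 + 2 * n + i]? = [Passage.virt 0, Passage.over 2, Passage.under 1,
      Passage.under 4, Passage.virt 1, Passage.over 5, Passage.over 4, Passage.virt 1,
      Passage.under 5][i]? := by
  have : (endLoop n).length = 4 := by unfold endLoop; split_ifs <;> rfl
  simp only [kmWord, List.append_assoc]
  rw [List.getElem?_append_right (by simp; omega),
    List.getElem?_append_right (by simp [twistForth]; omega),
    List.getElem?_append_right (by simp [twistForth, this]; omega),
    List.getElem?_append_right (by simp [twistForth, twistBack, this]; omega)]
  have e : 7 + 2 * n + i - [Passage.under 0, Passage.over 3, Passage.virt 0].length -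
      (twistForth b n).length - (endLoop n).length - (twistBack b n).length = i := by
    simp [twistForth, twistBack, this]; omega
  rw [e]; rfl

/-- Each index of the Gauss word lies in one of its five parts. -/
theorem kmWord_index_cases (n i : ℕ) :
    i < 3 ∨ (∃ k < n, i = 3 + k) ∨ (∃ m < 4, i = 3 + n + m) ∨ (∃ k < n, i = 6 + 2 * n - k) ∨
      ∃ m, i = 7 + 2 * n + m := by
  by_cases h1 : i < 3
  · exact .inl h1
  by_cases h2 : i < 3 + n
  · exact .inr (.inl ⟨i - 3, by omega, by omega⟩)
  by_cases h3 : i < 7 + n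
  · exact .inr (.inr (.inl ⟨i - 3 - n, by omega, by omega⟩))
  by_cases h4 : i < 7 + 2 * n
  · exact .inr (.inr (.inr (.inl ⟨6 + 2 * n - i, by omega, by omega⟩)))
  · exact .inr (.inr (.inr (.inr ⟨i - (7 + 2 * n), by omega⟩)))

theorem kmWord_virt_index {b : Bool} {n i v : ℕ} (h : (kmWord b n)[i]? = some (Passage.virt v)) :
    i = 2 ∨ i = 7 + 2 * n ∨ i = 11 + 2 * n ∨ i = 14 + 2 * n := by
  rcases kmWord_index_cases n i with hi | ⟨k, hk, rfl⟩ | ⟨m, hm, rfl⟩ | ⟨k, hk, rfl⟩ | ⟨m, rfl⟩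
  · rw [kmWord_getElem?_start b n i hi] at h
    interval_cases i <;> simp_all
  · rw [kmWord_getElem?_forth b n k hk] at h
    split_ifs at h <;> simp_all
  · rw [kmWord_getElem?_loop b n m hm] at h
    unfold endLoop at h
    split_ifs at h <;> interval_cases m <;> simp_all
  · rw [kmWord_getElem?_back b n k hk] at h
    split_ifs at h <;> simp_all
  · rw [kmWord_getElem?_finish] at h
    rcases Nat.lt_or_ge m 9 with hm | hm
    · interval_cases m <;> simp_all <;> omega
    · rw [List.getElem?_eq_none (by simpa using hm)] at h
      simp at h

/-- A passage that occurs only once in a word determines its index. -/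
theorem List.index_unique_of_count_le_one {α : Type*} [DecidableEq α] {l : List α} {a : α}
    (h : l.count a ≤ 1) {i j : ℕ} (hi : l[i]? = some a) (hj : l[j]? = some a) : i = j := by
  by_contra hne
  obtain ⟨hi', hi⟩ := List.getElem?_eq_some_iff.1 hi
  obtain ⟨hj', hj⟩ := List.getElem?_eq_some_iff.1 hj
  have : List.Duplicate a l := by
    rw [List.duplicate_iff_exists_distinct_get]
    rcases Nat.lt_or_gt_of_ne hne with h | h
    · exact ⟨⟨i, hi'⟩, ⟨j, hj'⟩, h, hi.symm, hj.symm⟩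
    · exact ⟨⟨j, hj'⟩, ⟨i, hi'⟩, h, hj.symm, hi.symm⟩
  rw [List.duplicate_iff_two_le_count] at this
  omega

/-! ### Smoothing conditions at the crossings. -/

/-- The edges `x`, `y` enter a crossing and `x'`, `y'` leave it on the same strand; their labels
are compatible with the oriented smoothing if `o` and with the other smoothing otherwise. -/
def Smooth {γ : Type*} (o : Prop) (x x' y y' : γ) : Prop :=
  (o → x = y' ∧ y = x') ∧ (¬o → x = y ∧ x' = y')

theorem Smooth.comm {γ : Type*} {o : Prop} {x x' y y' : γ} :
    Smooth o x x' y y' ↔ Smooth o y y' x x' := by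
  unfold Smooth; grind

/-- Reversing one strand exchanges the two smoothings. This is what makes the core independent of
the parity of `n`. -/
theorem Smooth.reverse {γ : Type*} {o : Prop} {x x' y y' : γ} :
    Smooth o x x' y y' ↔ Smooth (¬o) x x' y' y := by
  unfold Smooth; grind

/-- `p` and `q` are the indices of the two passages of the crossing `c`. -/
def IsChord (w : List Passage) (c p q : ℕ) : Prop :=
  (w[p]? = some (Passage.over c) ∧ w[q]? = some (Passage.under c)) ∨
    (w[p]? = some (Passage.under c) ∧ w[q]? = some (Passage.over c))

/-- Each passage occurs at most once, so only one pair of positions matters. Given the sign, a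
smoothing does not see which strand is on top. -/
theorem VirtualKnotDiagram.smooth_iff {K : VirtualKnotDiagram} {S : Finset ℕ} {γ : Type*}
    {f : ℕ → γ} {c p q : ℕ} (h : IsChord K.word c p q) :
    K.CompatibleAt S f c ↔
      Smooth (c ∈ S ↔ K.sign c = 1) (f p) (f (p + 1)) (f q) (f (q + 1)) := by
  have ho := K.over_count c
  have hu := (K.under_count c).trans_le ho
  rcases h with ⟨hp, hq⟩ | ⟨hp, hq⟩
  · refine ⟨fun h => h p q hp hq, fun h i j hi hj => ?_⟩
    rw [List.index_unique_of_count_le_one ho hi hp, List.index_unique_of_count_le_one hu hj hq]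
    exact h
  · rw [Smooth.comm]
    refine ⟨fun h => h q p hq hp, fun h i j hi hj => ?_⟩
    rw [List.index_unique_of_count_le_one ho hi hq, List.index_unique_of_count_le_one hu hj hp]
    exact h

section chords

variable (b : Bool) (n : ℕ)

theorem isChord_twist {k : ℕ} (hk : k < n) : IsChord (kmWord b n) (6 + k) (3 + k)
    (6 + 2 * n - k) := by
  unfold IsChord
  rw [kmWord_getElem?_forth b n k hk, kmWord_getElem?_back b n k hk]
  split_ifs <;> simp

theorem isChord_four : IsChord (kmWord b n) 4 (10 + 2 * n) (13 + 2 * n) := by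
  refine .inr ⟨?_, ?_⟩
  · rw [show 10 + 2 * n = 7 + 2 * n + 3 by omega, kmWord_getElem?_finish]; rfl
  · rw [show 13 + 2 * n = 7 + 2 * n + 6 by omega, kmWord_getElem?_finish]; rfl

theorem isChord_five : IsChord (kmWord b n) 5 (12 + 2 * n) (15 + 2 * n) := by
  refine .inl ⟨?_, ?_⟩
  · rw [show 12 + 2 * n = 7 + 2 * n + 5 by omega, kmWord_getElem?_finish]; rfl
  · rw [show 15 + 2 * n = 7 + 2 * n + 8 by omega, kmWord_getElem?_finish]; rfl

theorem isChord_zero : IsChord (kmWord b n) 0 0 (3 + n + if Even n then 0 else 3) := by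
  refine .inr ⟨?_, ?_⟩
  · rw [kmWord_getElem?_start b n _ (by omega)]; rfl
  · rw [kmWord_getElem?_loop b n _ (by split_ifs <;> omega)]; unfold endLoop; split_ifs <;> rfl

theorem isChord_one : IsChord (kmWord b n) 1 (9 + 2 * n) (3 + n + if Even n then 1 else 2) := by
  refine .inr ⟨?_, ?_⟩
  · rw [show 9 + 2 * n = 7 + 2 * n + 2 by omega, kmWord_getElem?_finish]; rfl
  · rw [kmWord_getElem?_loop b n _ (by split_ifs <;> omega)]; unfold endLoop; split_ifs <;> rfl

theorem isChord_two : IsChord (kmWord b n) 2 (8 + 2 * n) (3 + n + if Even n then 2 else 1) := by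
  refine .inl ⟨?_, ?_⟩
  · rw [show 8 + 2 * n = 7 + 2 * n + 1 by omega, kmWord_getElem?_finish]; rfl
  · rw [kmWord_getElem?_loop b n _ (by split_ifs <;> omega)]; unfold endLoop; split_ifs <;> rfl

theorem isChord_three : IsChord (kmWord b n) 3 1 (3 + n + if Even n then 3 else 0) := by
  refine .inl ⟨?_, ?_⟩
  · rw [kmWord_getElem?_start b n _ (by omega)]; rfl
  · rw [kmWord_getElem?_loop b n _ (by split_ifs <;> omega)]; unfold endLoop; split_ifs <;> rfl

theorem isVirt_iff (i : ℕ) : (∃ v, (kmWord b n)[i]? = some (Passage.virt v)) ↔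
    i = 2 ∨ i = 7 + 2 * n ∨ i = 11 + 2 * n ∨ i = 14 + 2 * n := by
  refine ⟨fun ⟨v, h⟩ => kmWord_virt_index h, ?_⟩
  rintro (rfl | rfl | rfl | rfl)
  · exact ⟨0, by rw [kmWord_getElem?_start b n _ (by omega)]; rfl⟩
  · exact ⟨0, kmWord_getElem?_finish b n 0⟩
  · exact ⟨1, by rw [show 11 + 2 * n = 7 + 2 * n + 4 by omega, kmWord_getElem?_finish]; rfl⟩
  · exact ⟨1, by rw [show 14 + 2 * n = 7 + 2 * n + 7 by omega, kmWord_getElem?_finish]; rfl⟩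

end chords

/-! ### Splitting the coloring conditions into core and band. -/

/-- Compatibility of edge labels with a state at the crossings outside the twisted band, whose two
strands have the end labels `l`, `r` at the virtual crossing and `p`, `q` at the end loop. -/
def CoreColoring {γ : Type*} (S : Finset ℕ) (u : ℕ → γ) (l r p q : γ) : Prop :=
  u 16 = u 0 ∧ u 2 = l ∧ r = u 8 ∧ u 11 = u 12 ∧ u 14 = u 15 ∧
    Smooth (0 ∈ S) (u 0) (u 1) p (u 4) ∧ Smooth (1 ∉ S) (u 9) (u 10) (u 4) (u 5) ∧
    Smooth (2 ∉ S) (u 8) (u 9) (u 5) (u 6) ∧ Smooth (3 ∈ S) (u 1) (u 2) (u 6) q ∧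
    Smooth (4 ∉ S) (u 10) (u 11) (u 13) (u 14) ∧ Smooth (5 ∈ S) (u 12) (u 13) (u 15) (u 16)

/-- The edge of `K_m(t)` that corresponds to an edge of `K_m(0)`. -/
def coreEdge (n x : ℕ) : ℕ :=
  if x ≤ 3 then x else if x < 7 then (if Even n then x + n else 10 + n - x) else x + 2 * n

section compatibleAt

variable (b : Bool) (n : ℕ) (S : Finset ℕ) {γ : Type*} (f : ℕ → γ)

/-- For odd `n` the loop is run through backwards and the sign of the crossing is flipped. The two
changes cancel by `Smooth.reverse`, and `coreEdge` renumbers the loop accordingly. Crossings `1`,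
`2`, `3` work in the same way. -/
theorem compatibleAt_zero_iff : (kmDiagram b n).CompatibleAt S f 0 ↔
    Smooth (0 ∈ S) (f 0) (f 1) (if Even n then f (3 + n) else f (7 + n)) (f (coreEdge n 4)) := by
  rw [VirtualKnotDiagram.smooth_iff (isChord_zero b n)]
  by_cases hn : Even n
  · simp [kmDiagram, kmSign, hn, coreEdge, add_comm, ← add_assoc]
  · rw [Smooth.reverse]
    simp [kmDiagram, kmSign, hn, coreEdge,
      show 10 + n - 4 = 6 + n by omega]
    ring_nf

theorem compatibleAt_one_iff : (kmDiagram b n).CompatibleAt S f 1 ↔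
    Smooth (1 ∉ S) (f (coreEdge n 9)) (f (coreEdge n 10)) (f (coreEdge n 4))
      (f (coreEdge n 5)) := by
  rw [VirtualKnotDiagram.smooth_iff (isChord_one b n)]
  by_cases hn : Even n
  · simp [kmDiagram, kmSign, hn, coreEdge]
    ring_nf
  · rw [Smooth.reverse]
    simp [kmDiagram, kmSign, hn, coreEdge,
      show 10 + n - 4 = 6 + n by omega, show 10 + n - 5 = 5 + n by omega]
    ring_nf

theorem compatibleAt_two_iff : (kmDiagram b n).CompatibleAt S f 2 ↔
    Smooth (2 ∉ S) (f (coreEdge n 8)) (f (coreEdge n 9)) (f (coreEdge n 5))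
      (f (coreEdge n 6)) := by
  rw [VirtualKnotDiagram.smooth_iff (isChord_two b n)]
  by_cases hn : Even n
  · simp [kmDiagram, kmSign, hn, coreEdge]
    ring_nf
  · rw [Smooth.reverse]
    simp [kmDiagram, kmSign, hn, coreEdge,
      show 10 + n - 5 = 5 + n by omega, show 10 + n - 6 = 4 + n by omega]
    ring_nf

theorem compatibleAt_three_iff : (kmDiagram b n).CompatibleAt S f 3 ↔
    Smooth (3 ∈ S) (f 1) (f 2) (f (coreEdge n 6))
      (if Even n then f (7 + n) else f (3 + n)) := by
  rw [VirtualKnotDiagram.smooth_iff (isChord_three b n)]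
  by_cases hn : Even n
  · simp [kmDiagram, kmSign, hn, coreEdge]
    ring_nf
  · rw [Smooth.reverse]
    simp [kmDiagram, kmSign, hn, coreEdge,
      show 10 + n - 6 = 4 + n by omega]
    ring_nf

theorem compatibleAt_four_iff : (kmDiagram b n).CompatibleAt S f 4 ↔
    Smooth (4 ∉ S) (f (coreEdge n 10)) (f (coreEdge n 11)) (f (coreEdge n 13))
      (f (coreEdge n 14)) := by
  rw [VirtualKnotDiagram.smooth_iff (isChord_four b n)]
  simp [kmDiagram, kmSign, coreEdge]
  ring_nf

theorem compatibleAt_five_iff : (kmDiagram b n).CompatibleAt S f 5 ↔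
    Smooth (5 ∈ S) (f (coreEdge n 12)) (f (coreEdge n 13)) (f (coreEdge n 15))
      (f (coreEdge n 16)) := by
  rw [VirtualKnotDiagram.smooth_iff (isChord_five b n)]
  simp [kmDiagram, kmSign, coreEdge]
  ring_nf

/-- The second strand meets crossing `6 + k` on its way from level `k + 1` down to level `k`, hence
the order of its two labels. -/
theorem compatibleAt_twist_iff {k : ℕ} (hk : k < n) : (kmDiagram b n).CompatibleAt S f (6 + k) ↔
    Smooth (6 + k ∈ S ↔ b = true) (f (3 + k)) (f (3 + (k + 1)))
      (f (7 + 2 * n - (k + 1))) (f (7 + 2 * n - k)) := by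
  rw [VirtualKnotDiagram.smooth_iff (isChord_twist b n hk)]
  have e1 : ((kmDiagram b n).sign (6 + k) = 1) ↔ b = true := by
    rw [show 6 + k = k + 6 by omega]
    cases b <;> simp [kmDiagram, kmSign]
  rw [e1, show 7 + 2 * n - (k + 1) = 6 + 2 * n - k by omega,
    show 7 + 2 * n - k = 6 + 2 * n - k + 1 by omega]
  rfl

theorem compatibleAt_of_le {c : ℕ} (hc : 6 + n ≤ c) : (kmDiagram b n).CompatibleAt S f c := by
  intro i j hi hj
  have := kmWord_count_over b n c
  rw [if_neg (by omega), List.count_eq_zero] at this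
  exact absurd (List.mem_of_getElem? hi) this

theorem compatibleAt_all_iff : (∀ c, (kmDiagram b n).CompatibleAt S f c) ↔
    ((kmDiagram b n).CompatibleAt S f 0 ∧ (kmDiagram b n).CompatibleAt S f 1 ∧
    (kmDiagram b n).CompatibleAt S f 2 ∧ (kmDiagram b n).CompatibleAt S f 3 ∧
    (kmDiagram b n).CompatibleAt S f 4 ∧ (kmDiagram b n).CompatibleAt S f 5) ∧
    ∀ k < n, (kmDiagram b n).CompatibleAt S f (6 + k) := by
  refine ⟨fun h => ⟨⟨h 0, h 1, h 2, h 3, h 4, h 5⟩, fun k _ => h _⟩, ?_⟩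
  rintro ⟨⟨h0, h1, h2, h3, h4, h5⟩, h⟩ c
  rcases Nat.lt_or_ge c 6 with h6 | h6
  · interval_cases c <;> assumption
  · obtain ⟨k, rfl⟩ := Nat.exists_eq_add_of_le h6
    rcases Nat.lt_or_ge k n with hk | hk
    · exact h k hk
    · exact compatibleAt_of_le b n S f (by omega)

theorem virt_compatible_iff :
    (∀ i v, (kmDiagram b n).word[i]? = some (Passage.virt v) → f i = f (i + 1)) ↔
      f 2 = f 3 ∧ f (7 + 2 * n) = f (8 + 2 * n) ∧ f (11 + 2 * n) = f (12 + 2 * n) ∧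
        f (14 + 2 * n) = f (15 + 2 * n) := by
  have : (∀ i v, (kmDiagram b n).word[i]? = some (Passage.virt v) → f i = f (i + 1)) ↔
      ∀ i, (i = 2 ∨ i = 7 + 2 * n ∨ i = 11 + 2 * n ∨ i = 14 + 2 * n) → f i = f (i + 1) := by
    refine forall_congr' fun i => ?_
    rw [← isVirt_iff b n i, forall_exists_index]; rfl
  rw [this]
  simp only [forall_eq_or_imp, forall_eq]
  rw [show 7 + 2 * n + 1 = 8 + 2 * n by omega, show 11 + 2 * n + 1 = 12 + 2 * n by omega,
    show 14 + 2 * n + 1 = 15 + 2 * n by omega]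

end compatibleAt

theorem kmDiagram_isStateColoring_iff {b : Bool} {n : ℕ} {S : Finset ℕ} {γ : Type*} {f : ℕ → γ} :
    (kmDiagram b n).IsStateColoring S f ↔
      CoreColoring S (fun x => f (coreEdge n x)) (f 3) (f (7 + 2 * n))
        (if Even n then f (3 + n) else f (7 + n)) (if Even n then f (7 + n) else f (3 + n)) ∧
      ∀ k < n, Smooth (6 + k ∈ S ↔ b = true) (f (3 + k)) (f (3 + (k + 1)))
        (f (7 + 2 * n - (k + 1))) (f (7 + 2 * n - k)) := by
  have hlen : (kmDiagram b n).word.length = 16 + 2 * n := length_kmWord b n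
  have ht := forall₂_congr fun k (hk : k < n) => compatibleAt_twist_iff b n S f hk
  unfold VirtualKnotDiagram.IsStateColoring CoreColoring
  rw [virt_compatible_iff, hlen, compatibleAt_all_iff, ht, compatibleAt_zero_iff,
    compatibleAt_one_iff, compatibleAt_two_iff, compatibleAt_three_iff, compatibleAt_four_iff,
    compatibleAt_five_iff]
  have e (m : ℕ) (hm : 7 ≤ m) : coreEdge n m = m + 2 * n := by
    unfold coreEdge; grind
  have e0 : coreEdge n 0 = 0 := rfl
  have e1 : coreEdge n 1 = 1 := rfl
  have e2 : coreEdge n 2 = 2 := rfl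
  simp only [e0, e1, e2, e 8 (by omega), e 11 (by omega), e 12 (by omega), e 14 (by omega),
    e 15 (by omega), e 16 (by omega)]
  tauto

/-! ### Computing the components of the core states. -/

/-- A labelling of the vertices of the graph with the edges `ps` that separates its components. -/
def componentLabel : List (ℕ × ℕ) → ℕ → ℕ
  | [], x => x
  | (a, b) :: ps, x =>
    if componentLabel ps x = componentLabel ps b then componentLabel ps a else componentLabel ps x

theorem componentLabel_eq {ps : List (ℕ × ℕ)} {e : ℕ × ℕ} (h : e ∈ ps) :
    componentLabel ps e.1 = componentLabel ps e.2 := by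
  induction ps with
  | nil => simp at h
  | cons d ps ih =>
    rcases List.mem_cons.1 h with rfl | h
    · simp [componentLabel]
    · simp [componentLabel, ih h]

/-- The label of `x` is itself a vertex connected to `x`. Together with `componentLabel_eq` this
says that labels agree exactly on components. -/
theorem apply_componentLabel {γ : Type*} {f : ℕ → γ} {ps : List (ℕ × ℕ)}
    (h : ∀ e ∈ ps, f e.1 = f e.2) (x : ℕ) : f (componentLabel ps x) = f x := by
  induction ps generalizing x with
  | nil => rfl
  | cons d ps ih =>
    have ih := ih fun e he => h e (List.mem_cons_of_mem _ he)
    simp only [componentLabel]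
    split_ifs with hx
    · rw [ih, h d (by simp), ← ih, ← hx, ih]
    · exact ih x

/-- The labels of the vertices `0, …, N - 1`. -/
def componentLabels (N : ℕ) : List (ℕ × ℕ) → List ℕ
  | [] => List.range N
  | (a, b) :: ps =>
    let l := componentLabels N ps
    let i := l.getD a 0
    let j := l.getD b 0
    l.map fun x => if x = j then i else x

/-- `componentLabel` branches at every edge; the list keeps all labels at once, which makes
evaluation in the kernel feasible. -/
theorem componentLabels_eq {N : ℕ} {ps : List (ℕ × ℕ)} (h : ∀ e ∈ ps, e.1 < N ∧ e.2 < N) :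
    componentLabels N ps = (List.range N).map (componentLabel ps) := by
  induction ps with
  | nil => exact (List.map_id _).symm
  | cons d ps ih =>
    have hd := h d (by simp)
    rw [componentLabels, ih fun e he => h e (List.mem_cons_of_mem _ he)]
    simp [hd.1, hd.2, componentLabel]

/-- The number of components of the graph on `0, …, N - 1` with the edges `ps`. -/
def componentCount (N : ℕ) (ps : List (ℕ × ℕ)) : ℕ := (componentLabels N ps).dedup.length

theorem componentCount_eq {N : ℕ} {ps : List (ℕ × ℕ)} (h : ∀ e ∈ ps, e.1 < N ∧ e.2 < N) :
    componentCount N ps = ((Finset.range N).image (componentLabel ps)).card := by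
  rw [componentCount, componentLabels_eq h, ← List.card_toFinset]
  congr 1

/-- The pairs of edges joined by a smoothing of a crossing. -/
def smoothPairs (o : Bool) (x x' y y' : ℕ) : List (ℕ × ℕ) :=
  if o then [(x, y'), (y, x')] else [(x, y), (x', y')]

/-- The pairs of edges joined in a state at the crossings outside the twisted band, whose two
strands are straight if `cut` is false and closed off at both ends otherwise. -/
def corePairs (cut : Bool) (S : Finset ℕ) : List (ℕ × ℕ) :=
  [(16, 0), (2, 3), (if cut then 3 else 7, 8), (11, 12), (14, 15)] ++
    smoothPairs (decide (0 ∈ S)) 0 1 (if cut then 7 else 3) 4 ++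
    smoothPairs (decide (1 ∉ S)) 9 10 4 5 ++ smoothPairs (decide (2 ∉ S)) 8 9 5 6 ++
    smoothPairs (decide (3 ∈ S)) 1 2 6 7 ++ smoothPairs (decide (4 ∉ S)) 10 11 13 14 ++
    smoothPairs (decide (5 ∈ S)) 12 13 15 16

theorem corePairs_lt {cut : Bool} {S : Finset ℕ} : ∀ e ∈ corePairs cut S, e.1 < 17 ∧ e.2 < 17 := by
  have hs (o : Bool) (x x' y y' : ℕ) (hx : x < 17 ∧ x' < 17 ∧ y < 17 ∧ y' < 17) :
      ∀ e ∈ smoothPairs o x x' y y', e.1 < 17 ∧ e.2 < 17 := by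
    unfold smoothPairs; grind
  unfold corePairs
  simp only [List.forall_mem_append]
  cases cut <;> refine ⟨⟨⟨⟨⟨⟨by simp, ?_⟩, ?_⟩, ?_⟩, ?_⟩, ?_⟩, ?_⟩ <;> apply hs <;> simp

theorem corePairs_iff {γ : Type*} {f : ℕ → γ} {cut : Bool} {S : Finset ℕ} :
    (∀ e ∈ corePairs cut S, f e.1 = f e.2) ↔
      CoreColoring S f (f 3) (f (if cut then 3 else 7)) (f (if cut then 7 else 3)) (f 7) := by
  have hs (o : Prop) [Decidable o] (x x' y y' : ℕ) :
      (∀ e ∈ smoothPairs (decide o) x x' y y', f e.1 = f e.2) ↔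
        Smooth o (f x) (f x') (f y) (f y') := by
    unfold smoothPairs Smooth; split_ifs <;> simp_all
  unfold corePairs CoreColoring
  simp only [List.forall_mem_append, hs]
  simp only [List.forall_mem_cons, List.not_mem_nil, false_imp_iff, implies_true, and_true]
  tauto

/-- The number of curves of a state outside the twisted band. -/
def coreCount (cut : Bool) (S : Finset ℕ) : ℕ := componentCount 17 (corePairs cut S)

/-- Needed because the exponent `|s| - 1` is a truncated subtraction. -/
theorem one_le_coreCount (cut : Bool) (S : Finset ℕ) : 1 ≤ coreCount cut S := by
  rw [coreCount, componentCount_eq corePairs_lt, Nat.one_le_iff_ne_zero, Finset.card_ne_zero]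
  simp

/-- The 64 core states, tabulated by number of `α`-smoothings and number of curves; the state sum
depends on nothing else. -/
theorem coreCount_straight :
    (Finset.range 6).powerset.val.map (fun S => (S.card, coreCount false S)) =
      Multiset.replicate 1 (0, 2) + Multiset.replicate 2 (1, 1) + Multiset.replicate 2 (1, 2) +
      Multiset.replicate 2 (1, 3) + Multiset.replicate 4 (2, 1) + Multiset.replicate 7 (2, 2) +
      Multiset.replicate 3 (2, 3) + Multiset.replicate 1 (2, 4) + Multiset.replicate 6 (3, 1) +
      Multiset.replicate 8 (3, 2) + Multiset.replicate 5 (3, 3) + Multiset.replicate 1 (3, 4) +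
      Multiset.replicate 5 (4, 1) + Multiset.replicate 7 (4, 2) + Multiset.replicate 3 (4, 3) +
      Multiset.replicate 3 (5, 1) + Multiset.replicate 3 (5, 2) + Multiset.replicate 1 (6, 1) := by
  decide +kernel

theorem coreCount_cut :
    (Finset.range 6).powerset.val.map (fun S => (S.card, coreCount true S)) =
      Multiset.replicate 1 (0, 2) + Multiset.replicate 2 (1, 1) + Multiset.replicate 1 (1, 2) +
      Multiset.replicate 3 (1, 3) + Multiset.replicate 2 (2, 1) + Multiset.replicate 8 (2, 2) +
      Multiset.replicate 2 (2, 3) + Multiset.replicate 3 (2, 4) + Multiset.replicate 4 (3, 1) +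
      Multiset.replicate 5 (3, 2) + Multiset.replicate 9 (3, 3) + Multiset.replicate 1 (3, 4) +
      Multiset.replicate 1 (3, 5) + Multiset.replicate 2 (4, 1) + Multiset.replicate 8 (4, 2) +
      Multiset.replicate 2 (4, 3) + Multiset.replicate 3 (4, 4) + Multiset.replicate 2 (5, 1) +
      Multiset.replicate 1 (5, 2) + Multiset.replicate 3 (5, 3) + Multiset.replicate 1 (6, 2) := by
  decide +kernel

/-! ### State sums of the core. -/

theorem core_sum_eq (cut : Bool) :
    ∑ S ∈ (Finset.range 6).powerset, T (2 * (S.card : ℤ) - 6) *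
      (-T (-2) - T 2 : ℤ[T;T⁻¹]) ^ (coreCount cut S - 1) =
    (((Finset.range 6).powerset.val.map (fun S => (S.card, coreCount cut S))).map fun y =>
      T (2 * (y.1 : ℤ) - 6) * (-T (-2) - T 2 : ℤ[T;T⁻¹]) ^ (y.2 - 1)).sum := by
  rw [Multiset.map_map]; rfl

/-- This is the bracket of `K_m(0)`. After the table is inserted, it is a polynomial identity in `a
= A²` and `a' = A⁻²` modulo `a * a' = 1`. -/
theorem core_sum_straight :
    ∑ S ∈ (Finset.range 6).powerset, T (2 * (S.card : ℤ) - 6) *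
      (-T (-2) - T 2 : ℤ[T;T⁻¹]) ^ (coreCount false S - 1) = 1 := by
  rw [core_sum_eq, coreCount_straight]
  simp only [Multiset.map_add, Multiset.map_replicate, Multiset.sum_add, Multiset.sum_replicate,
    nsmul_eq_mul]
  have h : (T 2 * T (-2) : ℤ[T;T⁻¹]) = 1 := by rw [← T_add]; rfl
  have h4 : (T 4 : ℤ[T;T⁻¹]) = T 2 ^ 2 := by rw [T_pow]; rfl
  have h6 : (T 6 : ℤ[T;T⁻¹]) = T 2 ^ 3 := by rw [T_pow]; rfl
  have h4' : (T (-4) : ℤ[T;T⁻¹]) = T (-2) ^ 2 := by rw [T_pow]; rfl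
  have h6' : (T (-6) : ℤ[T;T⁻¹]) = T (-2) ^ 3 := by rw [T_pow]; rfl
  norm_num [h4, h6, h4', h6', -T_pow]
  generalize (T 2 : ℤ[T;T⁻¹]) = a at *
  generalize (T (-2) : ℤ[T;T⁻¹]) = a' at *
  clear h4 h6 h4' h6'
  grind

/-- The value is `d`, the bracket of two disjoint circles. -/
theorem core_sum_cut :
    ∑ S ∈ (Finset.range 6).powerset, T (2 * (S.card : ℤ) - 6) *
      (-T (-2) - T 2 : ℤ[T;T⁻¹]) ^ (coreCount true S - 1) = -T (-2) - T 2 := by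
  rw [core_sum_eq, coreCount_cut]
  simp only [Multiset.map_add, Multiset.map_replicate, Multiset.sum_add, Multiset.sum_replicate,
    nsmul_eq_mul]
  have h : (T 2 * T (-2) : ℤ[T;T⁻¹]) = 1 := by rw [← T_add]; rfl
  have h4 : (T 4 : ℤ[T;T⁻¹]) = T 2 ^ 2 := by rw [T_pow]; rfl
  have h6 : (T 6 : ℤ[T;T⁻¹]) = T 2 ^ 3 := by rw [T_pow]; rfl
  have h4' : (T (-4) : ℤ[T;T⁻¹]) = T (-2) ^ 2 := by rw [T_pow]; rfl
  have h6' : (T (-6) : ℤ[T;T⁻¹]) = T (-2) ^ 3 := by rw [T_pow]; rfl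
  norm_num [h4, h6, h4', h6', -T_pow]
  generalize (T 2 : ℤ[T;T⁻¹]) = a at *
  generalize (T (-2) : ℤ[T;T⁻¹]) = a' at *
  clear h4 h6 h4' h6'
  grind

/-! ### Edge labellings assembled from core and band. -/

/-- Edge labels of `K_m(t)` made of labels `u` outside the twisted band and labels `α`, `β` along
its two strands. -/
def bandLabels {γ : Type*} (n : ℕ) (u α β : ℕ → γ) (x : ℕ) : γ :=
  if x < 3 then u x else if x ≤ 3 + n then α (x - 3) else
    if x < 7 + n then u (if Even n then x - n else 10 + n - x) else
      if x ≤ 7 + 2 * n then β (7 + 2 * n - x) else u (x - 2 * n)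

section bandLabels

variable {γ : Type*} {n : ℕ} {u α β : ℕ → γ}

theorem bandLabels_forth {k : ℕ} (hk : k ≤ n) : bandLabels n u α β (3 + k) = α k := by
  simp [bandLabels, hk]

theorem bandLabels_back {k : ℕ} (hk : k ≤ n) : bandLabels n u α β (7 + 2 * n - k) = β k := by
  unfold bandLabels
  rw [if_neg (by omega), if_neg (by omega), if_neg (by omega), if_pos (by omega)]
  congr 1; omega

/-- The edges `3` and `7` are excluded because they are the strand ends at the virtual crossing,
labelled by `α 0` and `β 0`. -/
theorem bandLabels_coreEdge {x : ℕ} (h3 : x ≠ 3) (h7 : x ≠ 7) :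
    bandLabels n u α β (coreEdge n x) = u x := by
  unfold bandLabels coreEdge
  rcases Nat.lt_or_ge x 4 with h | h
  · rw [if_pos (by omega : x ≤ 3), if_pos (by omega)]
  · rw [if_neg (by omega : ¬ x ≤ 3)]
    rcases Nat.lt_or_ge x 7 with h' | h'
    · by_cases hn : Even n
      · simp only [h', hn, if_true]
        rw [if_neg (by omega), if_neg (by omega), if_pos (by omega)]
        congr 1; omega
      · simp only [h', hn, if_true, if_false]
        rw [if_neg (by omega), if_neg (by omega), if_pos (by omega)]
        congr 1; omega
    · rw [if_neg (by omega : ¬ x < 7), if_neg (by omega), if_neg (by omega), if_neg (by omega),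
        if_neg (by omega)]
      congr 1; omega

/-- Every edge is on one of the two strands of the band or outside of it. -/
theorem edge_cases (n x : ℕ) (hx : x ≤ 16 + 2 * n) :
    (∃ k ≤ n, x = 3 + k) ∨ (∃ k ≤ n, x = 7 + 2 * n - k) ∨
      ∃ y < 17, y ≠ 3 ∧ y ≠ 7 ∧ x = coreEdge n y := by
  unfold coreEdge
  by_cases h1 : x < 3
  · exact .inr (.inr ⟨x, by omega, by omega, by omega, by rw [if_pos (by omega)]⟩)
  by_cases h2 : x ≤ 3 + n
  · exact .inl ⟨x - 3, by omega, by omega⟩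
  by_cases h3 : x < 7 + n
  · refine .inr (.inr ?_)
    by_cases hn : Even n
    · exact ⟨x - n, by omega, by omega, by omega, by
        rw [if_neg (by omega), if_pos (by omega), if_pos hn]; omega⟩
    · exact ⟨10 + n - x, by omega, by omega, by omega, by
        rw [if_neg (by omega), if_pos (by omega), if_neg hn]; omega⟩
  by_cases h4 : x ≤ 7 + 2 * n
  · exact .inr (.inl ⟨7 + 2 * n - x, by omega, by omega⟩)
  · exact .inr (.inr ⟨x - 2 * n, by omega, by omega, by omega, by
      rw [if_neg (by omega), if_neg (by omega)]; omega⟩)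

theorem CoreColoring.congr {S : Finset ℕ} {u v : ℕ → γ} {l r p q : γ}
    (h : CoreColoring S u l r p q) (huv : ∀ x, x ≠ 3 → x ≠ 7 → u x = v x) :
    CoreColoring S v l r p q := by
  unfold CoreColoring at *
  simpa only [huv _ (by decide : (0 : ℕ) ≠ 3) (by decide), huv 1 (by decide) (by decide),
    huv 2 (by decide) (by decide), huv 4 (by decide) (by decide), huv 5 (by decide) (by decide),
    huv 6 (by decide) (by decide), huv 8 (by decide) (by decide), huv 9 (by decide) (by decide),
    huv 10 (by decide) (by decide), huv 11 (by decide) (by decide),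
    huv 12 (by decide) (by decide), huv 13 (by decide) (by decide),
    huv 14 (by decide) (by decide), huv 15 (by decide) (by decide),
    huv 16 (by decide) (by decide)] using h

theorem isStateColoring_bandLabels {b : Bool} {S : Finset ℕ}
    (h : CoreColoring S u (α 0) (β 0) (if Even n then α n else β n)
      (if Even n then β n else α n))
    (ht : ∀ k < n, Smooth (6 + k ∈ S ↔ b = true) (α k) (α (k + 1)) (β (k + 1)) (β k)) :
    (kmDiagram b n).IsStateColoring S (bandLabels n u α β) := by
  rw [kmDiagram_isStateColoring_iff]
  refine ⟨?_, fun k hk => ?_⟩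
  · have h0 := bandLabels_forth (u := u) (α := α) (β := β) (Nat.zero_le n)
    have hn := bandLabels_forth (u := u) (α := α) (β := β) (le_refl n)
    have h0' := bandLabels_back (u := u) (α := α) (β := β) (Nat.zero_le n)
    have hn' := bandLabels_back (u := u) (α := α) (β := β) (le_refl n)
    rw [show 7 + 2 * n - n = 7 + n by omega] at hn'
    rw [Nat.sub_zero] at h0'
    rw [Nat.add_zero] at h0
    rw [h0, h0', hn, hn']
    exact h.congr fun x h3 h7 => (bandLabels_coreEdge h3 h7).symm
  · rw [bandLabels_forth hk.le, bandLabels_forth hk, bandLabels_back hk.le, bandLabels_back hk]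
    exact ht k hk

end bandLabels

/-! ### Curves along the band and the curve count. -/

section curves

variable {γ : Type*} {n : ℕ} {α β : ℕ → γ}

/-- Without an oriented smoothing, the two strands of the band run through. -/
theorem strand_eq_of_straight (h : ∀ k < n, α k = β (k + 1) ∧ α (k + 1) = β k) {k : ℕ}
    (hk : k ≤ n) : α k = (if Even k then α 0 else β 0) ∧ β k = if Even k then β 0 else α 0 := by
  induction k with
  | zero => simp
  | succ k ih =>
    obtain ⟨h1, h2⟩ := h k hk
    obtain ⟨h3, h4⟩ := ih (by omega)
    rw [h2, ← h1, h3, h4]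
    by_cases hk : Even k <;> simp [hk, Nat.even_add_one]

variable {p : ℕ → Prop} [DecidablePred p]

/-- With an oriented smoothing, the two strands of the band have the same labels. -/
theorem strands_eq_of_cut (h : ∀ k < n, Smooth (p k) (α k) (α (k + 1)) (β (k + 1)) (β k))
    (hp : ∃ i < n, p i) {k : ℕ} (hk : k ≤ n) : α k = β k := by
  obtain ⟨i, hi, hpi⟩ := hp
  have hi0 := ((h i hi).1 hpi).1
  rcases Nat.lt_or_ge k i with h' | h'
  · refine Nat.decreasingInduction' (P := fun k => α k = β k) (fun j hj _ ih => ?_) h'.le hi0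
    have := h j (by omega)
    unfold Smooth at this
    by_cases hj : p j
    · exact (this.1 hj).1
    · rw [(this.2 hj).1, ← ih, (this.2 hj).2]
  · induction k, h' using Nat.le_induction with
    | base => exact hi0
    | succ j hj ih =>
      have := h j (by omega)
      unfold Smooth at this
      by_cases hj : p j
      · exact ((this.1 hj).2).symm
      · rw [(this.2 hj).2, ← ih (by omega), (this.2 hj).1]

/-- Between two oriented smoothings the labels do not change. -/
theorem strand_eq_of_count_eq
    (h : ∀ k < n, Smooth (p k) (α k) (α (k + 1)) (β (k + 1)) (β k))
    (hp : ∃ i < n, p i) {k l : ℕ} (hl : l ≤ n) (hkl : k ≤ l)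
    (hc : Nat.count p k = Nat.count p l) : α k = α l := by
  induction l, hkl using Nat.le_induction with
  | base => rfl
  | succ l hkl ih =>
    have h1 := Nat.count_monotone p hkl
    rw [Nat.count_succ] at hc
    split_ifs at hc with hpl
    · omega
    · rw [ih (by omega) hc, ((h l hl).2 hpl).1, strands_eq_of_cut h hp hl]

/-- The count grows by at most one per step, so every intermediate value occurs. Thus each circle
between two cuts is realized by an edge. -/
theorem exists_count_eq {i : ℕ} (hi : i ≤ Nat.count p n) : ∃ k ≤ n, Nat.count p k = i := by
  induction n with
  | zero => exact ⟨0, le_rfl, by simp_all⟩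
  | succ n ih =>
    rcases hi.eq_or_lt with h | h
    · exact ⟨n + 1, le_rfl, h.symm⟩
    · obtain ⟨k, hk, e⟩ := ih (by rw [Nat.count_succ] at h; split_ifs at h <;> omega)
      exact ⟨k, by omega, e⟩

end curves

theorem coreEdge_le (n : ℕ) {x : ℕ} (hx : x < 17) : coreEdge n x ≤ 16 + 2 * n := by
  unfold coreEdge; split_ifs <;> omega

theorem coreEdge_three (n : ℕ) : coreEdge n 3 = 3 := rfl

theorem coreEdge_seven (n : ℕ) : coreEdge n 7 = 7 + 2 * n := rfl

/-- `L` picks a representative vertex in each component of the core: it is constant on components,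
and every core coloring `f` is unchanged by composition with it. -/
theorem exists_coreLabel (cut : Bool) (S : Finset ℕ) : ∃ L : ℕ → ℕ,
    (∀ e ∈ corePairs cut S, L e.1 = L e.2) ∧
    (∀ {γ : Type} {f : ℕ → γ},
      CoreColoring S f (f 3) (f (if cut then 3 else 7)) (f (if cut then 7 else 3)) (f 7) →
        ∀ x, f (L x) = f x) ∧
    coreCount cut S = ((Finset.range 17).image L).card :=
  ⟨componentLabel (corePairs cut S), fun _ => componentLabel_eq,
    fun h => apply_componentLabel (corePairs_iff.2 h), componentCount_eq corePairs_lt⟩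

/-- The strands swap at every twist, so their labels alternate between those of core edges `3` and
`7`. -/
theorem curves_of_straight {b : Bool} {n : ℕ} {S : Finset ℕ}
    (hS : ∀ k < n, ¬(6 + k ∈ S ↔ b = true)) :
    (kmDiagram b n).curves S = coreCount false S := by
  have hlen : (kmDiagram b n).word.length = 16 + 2 * n := length_kmWord b n
  obtain ⟨L, hL, hLf, hcard⟩ := exists_coreLabel false S
  set cls := (kmDiagram b n).curveThrough S with hcls
  have hcol : (kmDiagram b n).IsStateColoring S
      (bandLabels n L (fun k => if Even k then L 3 else L 7)
        fun k => if Even k then L 7 else L 3) := by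
    refine isStateColoring_bandLabels ?_ fun k hk => ⟨fun h => absurd h (hS k hk), fun _ => ?_⟩
    · have := corePairs_iff.1 hL
      by_cases hn : Even n <;> simpa [hn] using this
    · by_cases hk : Even k <;> simp [hk, Nat.even_add_one]
  have huniv := kmDiagram_isStateColoring_iff.1
    ((kmDiagram b n).isStateColoring_curveThrough (S := S))
  rw [← hcls] at huniv
  obtain ⟨hcore, htw⟩ := huniv
  have hstr {k : ℕ} (hk : k ≤ n) := strand_eq_of_straight (α := fun k => cls (3 + k))
    (β := fun k => cls (7 + 2 * n - k)) (fun k hk => (htw k hk).2 (hS k hk)) hk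
  simp only [Nat.add_zero, Nat.sub_zero] at hstr
  have hresp : ∀ x, cls (coreEdge n (L x)) = cls (coreEdge n x) := by
    refine hLf (f := fun x => cls (coreEdge n x)) ?_
    have := hstr (le_refl n)
    rw [show 7 + 2 * n - n = 7 + n by omega] at this
    by_cases hn : Even n <;>
      simpa [hn, this, coreEdge_three, coreEdge_seven] using hcore
  -- The curve through an edge can be recovered from its explicit label, so different curves have
  -- different labels.
  have hback : ∀ x ≤ 16 + 2 * n, cls (coreEdge n (bandLabels n L
      (fun k => if Even k then L 3 else L 7) (fun k => if Even k then L 7 else L 3) x)) =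
        cls x := by
    intro x hx
    rcases edge_cases n x hx with ⟨k, hk, rfl⟩ | ⟨k, hk, rfl⟩ | ⟨y, hy, h3, h7, rfl⟩
    · rw [bandLabels_forth hk, (hstr hk).1]
      split_ifs <;> rw [hresp] <;> rfl
    · rw [bandLabels_back hk, (hstr hk).2]
      split_ifs <;> rw [hresp] <;> rfl
    · rw [bandLabels_coreEdge h3 h7, hresp]
  rw [hcard]
  refine hcol.curves_eq (fun x hx y hy h => ?_) _ fun c => ?_
  · rw [hlen] at hx hy
    rw [← hcls, ← hback x hx, ← hback y hy, h]
  · rw [hlen, Finset.mem_image]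
    constructor
    · rintro ⟨y, hy, rfl⟩
      rw [Finset.mem_range] at hy
      refine ⟨coreEdge n y, coreEdge_le n hy, ?_⟩
      by_cases h3 : y = 3
      · subst h3; exact bandLabels_forth (Nat.zero_le n)
      by_cases h7 : y = 7
      · subst h7; exact bandLabels_back (Nat.zero_le n)
      exact bandLabels_coreEdge h3 h7
    · rintro ⟨x, hx, rfl⟩
      rcases edge_cases n x hx with ⟨k, hk, rfl⟩ | ⟨k, hk, rfl⟩ | ⟨y, hy, h3, h7, rfl⟩
      · rw [bandLabels_forth hk]
        split_ifs
        · exact ⟨3, by simp, rfl⟩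
        · exact ⟨7, by simp, rfl⟩
      · rw [bandLabels_back hk]
        split_ifs
        · exact ⟨7, by simp, rfl⟩
        · exact ⟨3, by simp, rfl⟩
      · exact ⟨y, by simpa using hy, (bandLabels_coreEdge h3 h7).symm⟩

/-- The number of cuts before level `k` tells on which piece of the band one is. The first and last
pieces belong to core curves; the `j - 1` pieces between them close up to circles. -/
theorem curves_of_cut {b : Bool} {n : ℕ} {S : Finset ℕ}
    (hS : ∃ k < n, (6 + k ∈ S ↔ b = true)) :
    (kmDiagram b n).curves S =
      coreCount true S + (Nat.count (fun k => 6 + k ∈ S ↔ b = true) n - 1) := by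
  have hlen : (kmDiagram b n).word.length = 16 + 2 * n := length_kmWord b n
  set p : ℕ → Prop := fun k => 6 + k ∈ S ↔ b = true with hp
  set j := Nat.count p n with hj
  have hj0 : 0 < j := by
    obtain ⟨k, hk, hpk⟩ := hS
    exact (Nat.count_strict_mono hpk hk).trans_le' (Nat.zero_le _)
  obtain ⟨L, hL, hLf, hcard⟩ := exists_coreLabel true S
  set cls := (kmDiagram b n).curveThrough S with hcls
  set α : ℕ → ℕ ⊕ ℕ := fun k => if Nat.count p k = 0 then Sum.inl (L 3) else
    if Nat.count p k = j then Sum.inl (L 7) else Sum.inr (Nat.count p k - 1) with hα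
  have hα0 : α 0 = Sum.inl (L 3) := by simp [hα]
  have hαn : α n = Sum.inl (L 7) := by simp [hα, ← hj, hj0.ne']
  have hcol : (kmDiagram b n).IsStateColoring S
      (bandLabels n (fun x => Sum.inl (L x)) α α) := by
    refine isStateColoring_bandLabels ?_ fun k hk => ⟨fun _ => ⟨rfl, rfl⟩, fun h => ?_⟩
    · have := corePairs_iff (f := fun x => Sum.inl (β := ℕ) (L x)).1 fun e he =>
        congrArg (Sum.inl (β := ℕ)) (hL e he)
      simpa [hα0, hαn] using this
    · have : α k = α (k + 1) := by simp only [hα, Nat.count_succ, hp, h, if_false, add_zero]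
      exact ⟨this, this.symm⟩
  have huniv := kmDiagram_isStateColoring_iff.1
    ((kmDiagram b n).isStateColoring_curveThrough (S := S))
  rw [← hcls] at huniv
  obtain ⟨hcore, htw⟩ := huniv
  have hstr {k : ℕ} (hk : k ≤ n) : cls (3 + k) = cls (7 + 2 * n - k) :=
    strands_eq_of_cut (α := fun k => cls (3 + k)) (β := fun k => cls (7 + 2 * n - k)) htw hS hk
  have hcount {k l : ℕ} (hk : k ≤ n) (hl : l ≤ n) (h : Nat.count p k = Nat.count p l) :
      cls (3 + k) = cls (3 + l) := by
    rcases Nat.le_total k l with hkl | hkl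
    · exact strand_eq_of_count_eq (α := fun k => cls (3 + k))
        (β := fun k => cls (7 + 2 * n - k)) htw hS hl hkl h
    · exact (strand_eq_of_count_eq (α := fun k => cls (3 + k))
        (β := fun k => cls (7 + 2 * n - k)) htw hS hk hkl h.symm).symm
  -- In the cut core, vertex `7` stands for the band end at the loop, whereas `coreEdge n 7` is the
  -- edge at the virtual crossing; so its value is replaced by that of edge `3 + n`.
  set r : ℕ → Quot ((kmDiagram b n).Joined S) :=
    fun x => if x = 7 then cls (3 + n) else cls (coreEdge n x) with hr
  have hresp : ∀ x, r (L x) = r x := by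
    refine hLf (f := r) ?_
    have h0 := hstr (Nat.zero_le n)
    have hn := hstr (le_refl n)
    rw [show 7 + 2 * n - n = 7 + n by omega] at hn
    rw [Nat.add_zero, Nat.sub_zero] at h0
    rw [← h0, ← hn, ite_self] at hcore
    have := hcore.congr (v := r) fun x h3 h7 => by simp [hr, h7]
    simpa [hr, coreEdge_three] using this
  have hsplit (x : ℕ) (hx : x ≤ 16 + 2 * n) :
      (∃ k ≤ n, cls x = cls (3 + k) ∧ bandLabels n (fun x => Sum.inl (L x)) α α x = α k) ∨
        ∃ y < 17, cls x = r y ∧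
          bandLabels n (fun x => Sum.inl (L x)) α α x = Sum.inl (L y) := by
    rcases edge_cases n x hx with ⟨k, hk, rfl⟩ | ⟨k, hk, rfl⟩ | ⟨y, hy, h3, h7, rfl⟩
    · exact .inl ⟨k, hk, rfl, bandLabels_forth hk⟩
    · exact .inl ⟨k, hk, (hstr hk).symm, bandLabels_back hk⟩
    · exact .inr ⟨y, hy, by simp [hr, h7], bandLabels_coreEdge h3 h7⟩
  -- The pieces with count `0` and `j` are absorbed into core vertices `3` and `7`; only the inner
  -- circles keep `Sum.inr` labels.
  have hsplit' (x : ℕ) (hx : x ≤ 16 + 2 * n) :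
      (∃ k ≤ n, cls x = cls (3 + k) ∧ Nat.count p k ≠ 0 ∧ Nat.count p k ≠ j ∧
        bandLabels n (fun x => Sum.inl (L x)) α α x = Sum.inr (Nat.count p k - 1)) ∨
        ∃ y < 17, cls x = r y ∧
          bandLabels n (fun x => Sum.inl (L x)) α α x = Sum.inl (L y) := by
    rcases hsplit x hx with ⟨k, hk, h1, h2⟩ | h
    · by_cases hc : Nat.count p k = 0
      · refine .inr ⟨3, by omega, ?_, by rw [h2]; simp [hα, hc]⟩
        rw [h1, hcount hk (Nat.zero_le n) (by simpa using hc)]; rfl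
      by_cases hc' : Nat.count p k = j
      · refine .inr ⟨7, by omega, ?_, by rw [h2]; simp [hα, hc', hj0.ne']⟩
        rw [h1, hcount hk le_rfl hc']; rfl
      exact .inl ⟨k, hk, h1, hc, hc', by rw [h2]; simp [hα, hc, hc']⟩
    · exact .inr h
  rw [hcard, ← Finset.card_range (j - 1),
    ← Finset.card_disjSum]
  refine hcol.curves_eq (fun x hx y hy h => ?_) _ fun c => ?_
  · rw [hlen] at hx hy
    rw [← hcls]
    rcases hsplit' x hx with ⟨k, hk, h1, h2, h3, h4⟩ | ⟨z, hz, h1, h2⟩ <;>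
      rcases hsplit' y hy with ⟨k', hk', h1', h2', h3', h4'⟩ | ⟨z', hz', h1', h2'⟩
    · rw [h4, h4', Sum.inr.injEq] at h
      rw [h1, h1', hcount hk hk' (by omega)]
    · rw [h4, h2'] at h; simp at h
    · rw [h2, h4'] at h; simp at h
    · rw [h2, h2', Sum.inl.injEq] at h
      rw [h1, h1', ← hresp z, ← hresp z', h]
  · rw [hlen]
    constructor
    · intro hc
      rcases Finset.mem_disjSum.1 hc with ⟨a, ha, rfl⟩ | ⟨i, hi, rfl⟩
      · obtain ⟨y, hy, rfl⟩ := Finset.mem_image.1 ha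
        rw [Finset.mem_range] at hy
        by_cases h3 : y = 3
        · subst h3
          exact ⟨3 + 0, by omega, by rw [bandLabels_forth (Nat.zero_le n), hα0]⟩
        by_cases h7 : y = 7
        · subst h7
          exact ⟨3 + n, by omega, by rw [bandLabels_forth le_rfl, hαn]⟩
        exact ⟨coreEdge n y, coreEdge_le n hy, bandLabels_coreEdge h3 h7⟩
      · rw [Finset.mem_range] at hi
        obtain ⟨k, hk, e⟩ := exists_count_eq (p := p) (n := n) (i := i + 1) (by omega)
        refine ⟨3 + k, by omega, ?_⟩
        rw [bandLabels_forth hk]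
        simp only [hα, e]
        rw [if_neg (by omega), if_neg (by omega), Nat.add_sub_cancel]
    · rintro ⟨x, hx, rfl⟩
      rcases hsplit' x hx with ⟨k, hk, h1, h2, h3, h4⟩ | ⟨z, hz, h1, h2⟩
      · rw [h4, Finset.inr_mem_disjSum, Finset.mem_range]
        have := Nat.count_monotone p hk
        omega
      · rw [h2, Finset.inl_mem_disjSum]
        exact Finset.mem_image_of_mem _ (by simpa using hz)

/-! ### Writhe and the full state sum. -/

theorem kmDiagram_crossings (b : Bool) (n : ℕ) :
    (kmDiagram b n).crossings = Finset.range (6 + n) := by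
  ext c
  have h : c ∈ (kmDiagram b n).crossings ↔ Passage.over c ∈ kmWord b n := by
    simp only [VirtualKnotDiagram.crossings, List.mem_toFinset, List.mem_filterMap]
    constructor
    · rintro ⟨p, hp, h⟩
      cases p <;> simp_all [kmDiagram]
    · exact fun h => ⟨_, h, rfl⟩
  rw [h, ← List.count_pos_iff, kmWord_count_over, Finset.mem_range]
  split_ifs <;> simp_all

theorem kmDiagram_writhe (b : Bool) (n : ℕ) :
    (kmDiagram b n).writhe = if b then (n : ℤ) else -n := by
  rw [VirtualKnotDiagram.writhe, kmDiagram_crossings, Finset.sum_range_add]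
  have e (k : ℕ) : (kmDiagram b n).sign (6 + k) = if b then 1 else -1 := by
    rw [show 6 + k = k + 6 by omega]; rfl
  simp only [e, Finset.sum_const, Finset.card_range]
  by_cases hn : Even n <;> cases b <;>
    simp [Finset.sum_range_succ, kmDiagram, kmSign, hn]

theorem corePairs_inter (cut : Bool) (S : Finset ℕ) :
    corePairs cut (S ∩ Finset.range 6) = corePairs cut S := by
  simp [corePairs]

theorem coreCount_inter (cut : Bool) (S : Finset ℕ) :
    coreCount cut (S ∩ Finset.range 6) = coreCount cut S := by
  rw [coreCount, corePairs_inter, coreCount]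

/-- The half twists with an oriented smoothing in the state `S`. -/
def orientedTwists (b : Bool) (n : ℕ) (S : Finset ℕ) : Finset ℕ :=
  (Finset.range n).filter fun k => 6 + k ∈ S ↔ b = true

/-- The state with the smoothings `P` outside the twisted band and the oriented smoothings `J` of
half twists. -/
def stateOf (b : Bool) (n : ℕ) (P J : Finset ℕ) : Finset ℕ :=
  (Finset.range (6 + n)).filter fun c => if c < 6 then c ∈ P else (c - 6 ∈ J ↔ b = true)

theorem card_state {n : ℕ} {S : Finset ℕ} (hS : S ⊆ Finset.range (6 + n)) :
    S.card = (S ∩ Finset.range 6).card + ((Finset.range n).filter fun k => 6 + k ∈ S).card := by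
  have h : S = (S ∩ Finset.range 6) ∪
      (((Finset.range n).filter fun k => 6 + k ∈ S).map (addLeftEmbedding 6)) := by
    ext c
    simp only [Finset.mem_union, Finset.mem_inter, Finset.mem_range, Finset.mem_map,
      Finset.mem_filter, addLeftEmbedding_apply]
    constructor
    · intro hc
      have := Finset.mem_range.1 (hS hc)
      rcases Nat.lt_or_ge c 6 with h | h
      · exact .inl ⟨hc, h⟩
      · obtain ⟨k, rfl⟩ := Nat.exists_eq_add_of_le h
        exact .inr ⟨k, ⟨by omega, hc⟩, rfl⟩
    · rintro (⟨hc, _⟩ | ⟨k, ⟨_, hc⟩, rfl⟩) <;> exact hc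
  conv_lhs => rw [h]
  rw [Finset.card_union_of_disjoint, Finset.card_map]
  rw [Finset.disjoint_left]
  intro c hc hc'
  obtain ⟨k, _, rfl⟩ := Finset.mem_map.1 hc'
  simp at hc

/-- The exponent of a state, split into the parts outside and inside the twisted band. -/
theorem state_exponent (b : Bool) {n : ℕ} {S : Finset ℕ} (hS : S ⊆ Finset.range (6 + n)) :
    (S.card : ℤ) - ((Finset.range (6 + n) \ S).card : ℤ) =
      (2 * ((S ∩ Finset.range 6).card : ℤ) - 6) +
        (if b then 1 else -1) * (2 * ((orientedTwists b n S).card : ℤ) - n) := by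
  have h1 := card_state hS
  have h2 := Finset.card_sdiff_add_card_eq_card hS
  rw [Finset.card_range] at h2
  have h3 := Finset.card_filter_add_card_filter_not (s := Finset.range n) fun k => 6 + k ∈ S
  rw [Finset.card_range] at h3
  cases b
  · have : orientedTwists false n S = (Finset.range n).filter fun k => ¬ 6 + k ∈ S := by
      simp [orientedTwists]
    rw [this]
    simp only [Bool.false_eq_true, if_false]
    omega
  · have : orientedTwists true n S = (Finset.range n).filter fun k => 6 + k ∈ S := by
      simp [orientedTwists]
    rw [this]
    simp only [if_true]
    omega

theorem kmDiagram_curves (b : Bool) (n : ℕ) (S : Finset ℕ) :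
    (kmDiagram b n).curves S = if (orientedTwists b n S).card = 0 then
      coreCount false (S ∩ Finset.range 6) else
      coreCount true (S ∩ Finset.range 6) + ((orientedTwists b n S).card - 1) := by
  rw [coreCount_inter, coreCount_inter]
  split_ifs with h
  · apply curves_of_straight
    intro k hk hp
    rw [Finset.card_eq_zero, orientedTwists, Finset.filter_eq_empty_iff] at h
    exact h (Finset.mem_range.2 hk) hp
  · rw [curves_of_cut, Nat.count_eq_card_filter_range, orientedTwists]
    obtain ⟨k, hk⟩ := Finset.card_ne_zero.1 h
    exact ⟨k, by simpa [orientedTwists] using hk⟩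

set_option linter.constructorNameAsVariable false in
-- States correspond bijectively to pairs `(P, J)`, with `stateOf` as the inverse map.
theorem sum_states (b : Bool) (n : ℕ) {M : Type*} [AddCommMonoid M]
    (F : Finset ℕ → Finset ℕ → M) :
    ∑ S ∈ (Finset.range (6 + n)).powerset, F (S ∩ Finset.range 6) (orientedTwists b n S) =
      ∑ J ∈ (Finset.range n).powerset, ∑ P ∈ (Finset.range 6).powerset, F P J := by
  rw [Finset.sum_comm, ← Finset.sum_product']
  refine Finset.sum_nbij' (fun S => (S ∩ Finset.range 6, orientedTwists b n S))
    (fun x => stateOf b n x.1 x.2) (fun S hS => ?_) (fun x hx => ?_) (fun S hS => ?_)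
    (fun x hx => ?_) fun S hS => rfl
  · simp [orientedTwists]
  · simp [stateOf]
  · rw [Finset.mem_powerset] at hS
    ext c
    simp only [stateOf, orientedTwists, Finset.mem_filter, Finset.mem_range, Finset.mem_inter]
    constructor
    · rintro ⟨hc, h⟩
      split_ifs at h with h6
      · exact h.1
      · rw [show 6 + (c - 6) = c by omega] at h
        have : c - 6 < n := by omega
        tauto
    · intro hc
      have := Finset.mem_range.1 (hS hc)
      refine ⟨this, ?_⟩
      split_ifs with h6
      · exact ⟨hc, h6⟩
      · rw [show 6 + (c - 6) = c by omega]
        have : c - 6 < n := by omega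
        tauto
  · simp only [Finset.mem_product, Finset.mem_powerset] at hx
    obtain ⟨hP, hJ⟩ := hx
    refine Prod.ext ?_ ?_
    · ext c
      simp only [stateOf, Finset.mem_filter, Finset.mem_range, Finset.mem_inter]
      constructor
      · rintro ⟨⟨hc, h⟩, h6⟩
        rwa [if_pos h6] at h
      · intro hc
        have := Finset.mem_range.1 (hP hc)
        exact ⟨⟨this.trans_le (Nat.le_add_right 6 n), (if_pos this).symm ▸ hc⟩, this⟩
    · ext k
      simp only [stateOf, orientedTwists, Finset.mem_filter, Finset.mem_range]
      constructor
      · rintro ⟨hk, h⟩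
        simp only [add_lt_add_iff_left, hk, true_and, Nat.not_lt.2 (Nat.le_add_right 6 k),
          if_false, Nat.add_sub_cancel_left] at h
        tauto
      · intro hk
        have := Finset.mem_range.1 (hJ hk)
        refine ⟨this, ?_⟩
        simp only [add_lt_add_iff_left, this, true_and, Nat.not_lt.2 (Nat.le_add_right 6 k),
          if_false, Nat.add_sub_cancel_left]
        tauto

theorem kmDiagram_bracket (b : Bool) (n : ℕ) :
    (kmDiagram b n).bracket = (-T (3 * if b then 1 else -1)) ^ n := by
  set ε : ℤ := if b then 1 else -1 with hε
  have step (S : Finset ℕ) (hS : S ∈ (Finset.range (6 + n)).powerset) :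
      T ((S.card : ℤ) - ((Finset.range (6 + n) \ S).card : ℤ)) *
        (-T (-2) - T 2 : ℤ[T;T⁻¹]) ^ ((kmDiagram b n).curves S - 1) =
      (fun P J : Finset ℕ => T (ε * (2 * (J.card : ℤ) - n)) * (-T (-2) - T 2) ^ (J.card - 1) *
        (T (2 * (P.card : ℤ) - 6) *
          (-T (-2) - T 2 : ℤ[T;T⁻¹]) ^ (coreCount (decide (J.card ≠ 0)) P - 1)))
        (S ∩ Finset.range 6) (orientedTwists b n S) := by
    rw [state_exponent b (Finset.mem_powerset.1 hS), T_add, kmDiagram_curves, ← hε]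
    by_cases h : (orientedTwists b n S).card = 0
    -- For empty `J` the truncated exponent `J.card - 1` is `0`, so no spurious power of `d`
    -- appears.
    · simp only [h, if_true, ne_eq, not_true, decide_false, Nat.zero_sub, pow_zero]
      ring
    · have h1 := one_le_coreCount true (S ∩ Finset.range 6)
      simp only [h, if_false, ne_eq, not_false_eq_true, decide_true]
      rw [show ∀ x y : ℕ, 1 ≤ x → x + y - 1 = y + (x - 1) by omega, pow_add] <;> [ring; exact h1]
  rw [VirtualKnotDiagram.bracket, kmDiagram_crossings, Finset.sum_congr rfl step]
  refine (sum_states b n fun P J : Finset ℕ => T (ε * (2 * (J.card : ℤ) - n)) *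
    (-T (-2) - T 2) ^ (J.card - 1) * (T (2 * (P.card : ℤ) - 6) *
      (-T (-2) - T 2 : ℤ[T;T⁻¹]) ^ (coreCount (decide (J.card ≠ 0)) P - 1))).trans ?_
  have inner (J : Finset ℕ) (hJ : J ∈ (Finset.range n).powerset) :
      ∑ P ∈ (Finset.range 6).powerset,
        T (ε * (2 * (J.card : ℤ) - n)) * (-T (-2) - T 2) ^ (J.card - 1) *
        (T (2 * (P.card : ℤ) - 6) *
          (-T (-2) - T 2 : ℤ[T;T⁻¹]) ^ (coreCount (decide (J.card ≠ 0)) P - 1)) =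
      (T ε * (-T (-2) - T 2)) ^ J.card * T (-ε) ^ ((Finset.range n).card - J.card) := by
    have hle := Finset.card_le_card (Finset.mem_powerset.1 hJ)
    rw [Finset.card_range] at hle ⊢
    rw [← Finset.mul_sum, mul_pow, T_pow, T_pow]
    have e : ε * (2 * (J.card : ℤ) - n) = J.card * ε + ((n - J.card : ℕ) : ℤ) * -ε := by
      push_cast [hle]; ring
    rw [e, T_add]
    by_cases h : J.card = 0
    · simp only [h, ne_eq, not_true, decide_false, core_sum_straight]
      simp
    · simp only [h, ne_eq, not_false_eq_true, decide_true, core_sum_cut]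
      -- The cut core contributes the factor `d` that completes `d ^ (|J| - 1)` to `d ^ |J|`.
      rw [mul_assoc, ← pow_succ, Nat.sub_add_cancel (Nat.one_le_iff_ne_zero.2 h)]
      ring
  rw [Finset.sum_congr rfl inner, Finset.sum_pow_mul_eq_add_pow, Finset.card_range]
  congr 1
  -- In `A^ε d + A^{-ε}` the term `-A^{-ε}` of the product cancels and leaves `-A^{3ε}`.
  rw [mul_sub, mul_neg, ← T_add, ← T_add]
  cases b
  · simp [hε]
  · simp [hε]; ring

/-! ### The fundamental group. -/

namespace VirtualKnotDiagram

variable {K : VirtualKnotDiagram}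

/-- The element of the fundamental group given by the edge with number `i`. -/
def meridian (K : VirtualKnotDiagram) (i : ℕ) : K.fundamentalGroup :=
  PresentedGroup.of (Fin.ofNat _ i)

theorem meridian_eq {i : ℕ} (e : K.Edge) (h : e.val = i) :
    K.meridian i = PresentedGroup.of e := by
  subst h
  simp [meridian]

theorem mk_eq_of_isRelator {a c : FreeGroup K.Edge} (h : K.IsRelator (a * c⁻¹)) :
    PresentedGroup.mk {r | K.IsRelator r} a = PresentedGroup.mk {r | K.IsRelator r} c :=
  PresentedGroup.mk_eq_mk_of_mul_inv_mem h

theorem meridian_length : K.meridian K.word.length = K.meridian 0 := by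
  rw [meridian_eq (i := K.word.length) (Fin.last _) rfl, meridian_eq (i := 0) 0 rfl]
  exact mk_eq_of_isRelator .base

theorem meridian_virt {i v : ℕ} (hi : K.word[i]? = some (Passage.virt v)) :
    K.meridian (i + 1) = K.meridian i := by
  obtain ⟨h, hi⟩ := List.getElem?_eq_some_iff.1 hi
  rw [meridian_eq (i := i) (Fin.castSucc ⟨i, h⟩) rfl,
    meridian_eq (i := i + 1) (Fin.succ ⟨i, h⟩) rfl]
  exact mk_eq_of_isRelator (.virt _ v hi)

theorem meridian_over {i c : ℕ} (hi : K.word[i]? = some (Passage.over c)) :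
    K.meridian (i + 1) = K.meridian i := by
  obtain ⟨h, hi⟩ := List.getElem?_eq_some_iff.1 hi
  rw [meridian_eq (i := i) (Fin.castSucc ⟨i, h⟩) rfl,
    meridian_eq (i := i + 1) (Fin.succ ⟨i, h⟩) rfl]
  exact mk_eq_of_isRelator (.over _ c hi)

theorem meridian_under {i j c : ℕ} (hi : K.word[i]? = some (Passage.over c))
    (hj : K.word[j]? = some (Passage.under c)) :
    K.meridian (j + 1) = K.meridian i ^ (-(K.sign c : ℤ)) * K.meridian j *
      K.meridian i ^ (K.sign c : ℤ) := by
  obtain ⟨h, hi⟩ := List.getElem?_eq_some_iff.1 hi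
  obtain ⟨h', hj⟩ := List.getElem?_eq_some_iff.1 hj
  rw [meridian_eq (i := i) (Fin.castSucc ⟨i, h⟩) rfl,
    meridian_eq (i := j) (Fin.castSucc ⟨j, h'⟩) rfl,
    meridian_eq (i := j + 1) (Fin.succ ⟨j, h'⟩) rfl]
  have := mk_eq_of_isRelator (K := K) (.under c ⟨i, h⟩ ⟨j, h'⟩ hi hj)
  rw [map_mul, map_mul, map_zpow, map_zpow] at this
  exact this

/-- The homomorphism to `ℤ` that maps every meridian to `1`. -/
def linking (K : VirtualKnotDiagram) : K.fundamentalGroup →* Multiplicative ℤ :=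
  PresentedGroup.toGroup (f := fun _ => Multiplicative.ofAdd 1) (by
    rintro r (_ | _ | _ | _) <;> simp [mul_comm])

theorem linking_of (e : K.Edge) :
    K.linking (PresentedGroup.of e) = Multiplicative.ofAdd 1 :=
  PresentedGroup.toGroup.of _

/-- If all meridians agree, the fundamental group is infinite cyclic. -/
theorem fundamentalGroup_equiv (h : ∀ i ≤ K.word.length, K.meridian i = K.meridian 0) :
    Nonempty (K.fundamentalGroup ≃* Multiplicative ℤ) := by
  refine ⟨MonoidHom.toMulEquiv K.linking (zpowersHom _ (K.meridian 0)) ?_ ?_⟩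
  · ext e
    have := h e (Nat.le_of_lt_succ e.2)
    rw [meridian_eq e rfl] at this
    rw [MonoidHom.comp_apply, linking_of, MonoidHom.id_apply, this]
    simp
  · ext
    simp [meridian, linking_of]

end VirtualKnotDiagram

section meridians

variable (b : Bool) (n : ℕ)

local notation "μ" => VirtualKnotDiagram.meridian (kmDiagram b n)

theorem conj_zpow_of_eq {G : Type*} [Group G] {x y : G} {ε : ℤ} (h : x = y) :
    x ^ (-ε) * y * x ^ ε = y := by
  subst h
  group

theorem eq_of_eq_conj_zpow {G : Type*} [Group G] {x y : G} {ε : ℤ}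
    (h : x = x ^ (-ε) * y * x ^ ε) : y = x := by
  have : y = x ^ ε * (x ^ (-ε) * y * x ^ ε) * x ^ (-ε) := by group
  rw [this, ← h]; group

theorem finish_get (i : ℕ) {m : ℕ} {p : Passage} (h : i = 7 + 2 * n + m)
    (hp : [Passage.virt 0, Passage.over 2, Passage.under 1,
      Passage.under 4, Passage.virt 1, Passage.over 5, Passage.over 4, Passage.virt 1,
      Passage.under 5][m]? = some p) : (kmDiagram b n).word[i]? = some p := by
  rw [h]; exact (kmWord_getElem?_finish b n m).trans hp

theorem start_get {i : ℕ} {p : Passage} (hi : i < 3)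
    (hp : [Passage.under 0, Passage.over 3, Passage.virt 0][i]? = some p) :
    (kmDiagram b n).word[i]? = some p :=
  (kmWord_getElem?_start b n i hi).trans hp

/-- The overpasses and virtual crossings identify the arcs from crossing `4` to crossing `5`. At
both crossings the overarc then equals one of the two underarcs, which forces the other underarc to
agree. -/
theorem meridian_finish {m : ℕ} (hm : 10 ≤ m) (hm' : m ≤ 16) : μ (m + 2 * n) = μ 0 := by
  have h10 : μ (11 + 2 * n) = μ (12 + 2 * n) := by
    rw [show 12 + 2 * n = 11 + 2 * n + 1 by omega,
      VirtualKnotDiagram.meridian_virt (finish_get b n _ (m := 4) (by omega) rfl)]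
  have h12 : μ (13 + 2 * n) = μ (12 + 2 * n) := by
    rw [show 13 + 2 * n = 12 + 2 * n + 1 by omega,
      VirtualKnotDiagram.meridian_over (finish_get b n _ (m := 5) (by omega) rfl)]
  have h13 : μ (14 + 2 * n) = μ (13 + 2 * n) := by
    rw [show 14 + 2 * n = 13 + 2 * n + 1 by omega,
      VirtualKnotDiagram.meridian_over (finish_get b n _ (m := 6) (by omega) rfl)]
  have h14 : μ (15 + 2 * n) = μ (14 + 2 * n) := by
    rw [show 15 + 2 * n = 14 + 2 * n + 1 by omega,
      VirtualKnotDiagram.meridian_virt (finish_get b n _ (m := 7) (by omega) rfl)]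
  have h4 : μ (10 + 2 * n + 1) = _ := VirtualKnotDiagram.meridian_under
    (finish_get b n (13 + 2 * n) (m := 6) (by omega) rfl)
    (finish_get b n (10 + 2 * n) (m := 3) (by omega) rfl)
  have h5 : μ (15 + 2 * n + 1) = _ := VirtualKnotDiagram.meridian_under
    (finish_get b n (12 + 2 * n) (m := 5) (by omega) rfl)
    (finish_get b n (15 + 2 * n) (m := 8) (by omega) rfl)
  rw [conj_zpow_of_eq (by rw [h14, h13, h12]),
    show 15 + 2 * n + 1 = 16 + 2 * n by omega] at h5
  rw [show 10 + 2 * n + 1 = 11 + 2 * n by omega, h10, ← h12] at h4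
  have h4 := eq_of_eq_conj_zpow h4
  have h0 : μ (16 + 2 * n) = μ 0 := by
    have := (kmDiagram b n).meridian_length
    rwa [show (kmDiagram b n).word.length = 16 + 2 * n from length_kmWord b n] at this
  interval_cases m <;> simp only [h4, h10, h12, h13, h14, h5, ← h0]

/-- The arc that passes over the crossings `0` and `1`. -/
theorem meridian_loop_over : ∃ i, (kmDiagram b n).word[i]? = some (Passage.over 0) ∧
    ∃ j, (kmDiagram b n).word[j]? = some (Passage.over 1) ∧ μ i = μ j ∧
      (μ i = μ (3 + n) ∨ μ i = μ (7 + n)) := by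
  have hl (i : ℕ) (hi : i < 4) : (kmDiagram b n).word[3 + n + i]? = (endLoop n)[i]? :=
    kmWord_getElem?_loop b n i hi
  by_cases hn : Even n
  · have h0 : (kmDiagram b n).word[3 + n]? = some (Passage.over 0) :=
      (hl 0 (by omega)).trans (by simp [endLoop, hn])
    have h1 : (kmDiagram b n).word[3 + n + 1]? = some (Passage.over 1) :=
      (hl 1 (by omega)).trans (by simp [endLoop, hn])
    exact ⟨_, h0, _, h1, (VirtualKnotDiagram.meridian_over h0).symm, .inl rfl⟩
  · have h0 : (kmDiagram b n).word[3 + n + 3]? = some (Passage.over 0) :=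
      (hl 3 (by omega)).trans (by simp [endLoop, hn])
    have h1 : (kmDiagram b n).word[3 + n + 2]? = some (Passage.over 1) :=
      (hl 2 (by omega)).trans (by simp [endLoop, hn])
    -- For odd `n` the reversed loop ends, rather than begins, with this arc.
    refine ⟨_, h0, _, h1, VirtualKnotDiagram.meridian_over h1, .inr ?_⟩
    rw [← VirtualKnotDiagram.meridian_over h0]
    congr 1; omega

theorem meridian_start : μ 1 = μ 3 ∧ μ 2 = μ 3 := by
  have h1 := VirtualKnotDiagram.meridian_over (start_get b n (i := 1) (by omega) rfl)
  have h2 := VirtualKnotDiagram.meridian_virt (start_get b n (i := 2) (by omega) rfl)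
  exact ⟨by rw [h2, h1], h2.symm⟩

theorem meridian_middle : μ (8 + 2 * n) = μ (7 + 2 * n) ∧ μ (9 + 2 * n) = μ (7 + 2 * n) := by
  have h1 := VirtualKnotDiagram.meridian_virt (finish_get b n (7 + 2 * n) (m := 0) rfl rfl)
  have h2 := VirtualKnotDiagram.meridian_over
    (finish_get b n (8 + 2 * n) (m := 1) (by omega) rfl)
  rw [show 7 + 2 * n + 1 = 8 + 2 * n by omega] at h1
  rw [show 8 + 2 * n + 1 = 9 + 2 * n by omega] at h2
  exact ⟨h1, h2.trans h1⟩

/-- The two strands of the band have the same meridian at the virtual crossing. -/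
theorem meridian_band_ends : μ (7 + 2 * n) = μ 3 := by
  obtain ⟨i, hi, j, hj, hij, -⟩ := meridian_loop_over b n
  have h0 : μ (0 + 1) = _ :=
    VirtualKnotDiagram.meridian_under hi (start_get b n (i := 0) (by omega) rfl)
  have h1 : μ (9 + 2 * n + 1) = _ := VirtualKnotDiagram.meridian_under hj
    (finish_get b n (9 + 2 * n) (m := 2) (by omega) rfl)
  rw [show 9 + 2 * n + 1 = 10 + 2 * n by omega, meridian_finish b n le_rfl (by omega), ← hij,
    (meridian_middle b n).2] at h1
  -- With opposite signs, entering under crossing `0` and undoing the passage under crossing `1`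
  -- conjugate the base meridian in the same way.
  have hs : ((kmDiagram b n).sign 1 : ℤ) = -((kmDiagram b n).sign 0 : ℤ) := by
    by_cases hn : Even n <;> simp [kmDiagram, kmSign, hn]
  rw [zero_add, (meridian_start b n).1, h1, hs] at h0
  rw [h0]; group

/-- If both strands carry `x`, a twist keeps the upper label and conjugates the lower one by `x`, so
both remain `x`. -/
theorem meridian_band {k : ℕ} (hk : k ≤ n) : μ (3 + k) = μ 3 ∧ μ (7 + 2 * n - k) = μ 3 := by
  induction k with
  | zero => exact ⟨rfl, meridian_band_ends b n⟩
  | succ k ih =>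
    obtain ⟨h1, h2⟩ := ih (by omega)
    have hb : 7 + 2 * n - (k + 1) = 6 + 2 * n - k := by omega
    have hb' : 7 + 2 * n - k = 6 + 2 * n - k + 1 := by omega
    rw [hb]
    rw [hb'] at h2
    rcases isChord_twist b n (k := k) hk with ⟨ho, hu⟩ | ⟨hu, ho⟩
    · have e1 := VirtualKnotDiagram.meridian_over (K := kmDiagram b n) ho
      have e2 := VirtualKnotDiagram.meridian_under (K := kmDiagram b n) ho hu
      rw [h2, h1] at e2
      exact ⟨e1.trans h1, eq_of_eq_conj_zpow e2⟩
    · have e1 := VirtualKnotDiagram.meridian_over (K := kmDiagram b n) ho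
      have e2 := VirtualKnotDiagram.meridian_under (K := kmDiagram b n) ho hu
      rw [← e1, h2, h1, conj_zpow_of_eq rfl] at e2
      exact ⟨e2, e1.symm.trans h2⟩

/-- The arc over crossing `0` is an end of the band, so it carries the same meridian `x` as the
outgoing underarc there. Conjugation by `x` fixes `x`, so the incoming underarc is `x` as well. -/
theorem meridian_three : μ 3 = μ 0 := by
  obtain ⟨i, hi, j, hj, hij, h⟩ := meridian_loop_over b n
  have hb := meridian_band b n (le_refl n)
  rw [show 7 + 2 * n - n = 7 + n by omega] at hb
  rw [hb.1, hb.2, or_self] at h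
  have h0 : μ (0 + 1) = _ :=
    VirtualKnotDiagram.meridian_under hi (start_get b n (i := 0) (by omega) rfl)
  rw [zero_add, (meridian_start b n).1, h] at h0
  exact (eq_of_eq_conj_zpow h0).symm

theorem meridian_loop {m : ℕ} (hm : m ≤ 4) : μ (3 + n + m) = μ 0 := by
  have hl (i : ℕ) (hi : i < 4) : (kmDiagram b n).word[3 + n + i]? = (endLoop n)[i]? :=
    kmWord_getElem?_loop b n i hi
  have h3 {j : ℕ} := VirtualKnotDiagram.meridian_under (K := kmDiagram b n) (i := 1) (j := j)
    (c := 3) (start_get b n (by omega) rfl)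
  have h2 {j : ℕ} := VirtualKnotDiagram.meridian_under (K := kmDiagram b n) (i := 8 + 2 * n)
    (j := j) (c := 2) (finish_get b n _ (m := 1) (by omega) rfl)
  rw [(meridian_start b n).1, meridian_three] at h3
  rw [(meridian_middle b n).1, meridian_band_ends, meridian_three] at h2
  have h0 : μ (3 + n) = μ 0 := by rw [(meridian_band b n le_rfl).1, meridian_three]
  induction m with
  | zero => exact h0
  | succ m ih =>
    have ih := ih (by omega)
    have hm' := hl m (by omega)
    have hcases : (endLoop n)[m]? = some (Passage.over 0) ∨
        (endLoop n)[m]? = some (Passage.over 1) ∨ (endLoop n)[m]? = some (Passage.under 2) ∨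
        (endLoop n)[m]? = some (Passage.under 3) := by
      have : m < 4 := by omega
      unfold endLoop
      split_ifs <;> interval_cases m <;> simp
    rcases hcases with h | h | h | h <;> rw [h] at hm'
    · exact (VirtualKnotDiagram.meridian_over hm').trans ih
    · exact (VirtualKnotDiagram.meridian_over hm').trans ih
    · exact (h2 hm').trans (by rw [ih, conj_zpow_of_eq rfl])
    · exact (h3 hm').trans (by rw [ih, conj_zpow_of_eq rfl])

theorem meridian_eq_zero (i : ℕ) (hi : i ≤ 16 + 2 * n) : μ i = μ 0 := by
  by_cases h1 : i < 3
  · have := meridian_start b n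
    rw [meridian_three] at this
    interval_cases i <;> tauto
  by_cases h2 : i ≤ 3 + n
  · obtain ⟨k, rfl⟩ := Nat.exists_eq_add_of_le (Nat.not_lt.1 h1)
    rw [(meridian_band b n (by omega)).1, meridian_three]
  by_cases h3 : i ≤ 7 + n
  · obtain ⟨k, rfl⟩ := Nat.exists_eq_add_of_le (Nat.not_le.1 h2).le
    exact meridian_loop b n (by omega)
  by_cases h4 : i ≤ 7 + 2 * n
  · rw [show i = 7 + 2 * n - (7 + 2 * n - i) by omega, (meridian_band b n (by omega)).2,
      meridian_three]
  by_cases h5 : i < 10 + 2 * n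
  · have := meridian_middle b n
    rw [meridian_band_ends, meridian_three] at this
    obtain rfl | rfl : i = 8 + 2 * n ∨ i = 9 + 2 * n := by omega
    · exact this.1
    · exact this.2
  · rw [show i = i - 2 * n + 2 * n by omega]
    exact meridian_finish b n (by omega) (by omega)

end meridians

/-! ### The theorem for integer `t`. -/

theorem Km_eq (t : ℤ) : Km t = kmDiagram (decide (0 < t)) t.natAbs := rfl

theorem Km_bracket (t : ℤ) : (Km t).bracket = C ((Int.negOnePow t : ℤˣ) : ℤ) * T (3 * t) := by
  rw [Km_eq, kmDiagram_bracket, neg_pow, T_pow]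
  have h : (C ((Int.negOnePow t : ℤˣ) : ℤ) : ℤ[T;T⁻¹]) = (-1) ^ t.natAbs := by
    obtain ⟨m, rfl | rfl⟩ := t.eq_nat_or_neg <;> simp [Int.negOnePow]
  rw [h]
  congr 2
  -- For `t = 0` the Boolean is `false`, which is harmless since there are no twists.
  by_cases ht : 0 < t
  · simp only [ht, decide_true, if_true]; omega
  · simp only [ht, decide_false, Bool.false_eq_true, if_false]; omega

theorem Km_writhe (t : ℤ) : (Km t).writhe = t := by
  rw [Km_eq, kmDiagram_writhe]
  by_cases ht : 0 < t
  · simp only [ht, decide_true, if_true]; omega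
  · simp only [ht, decide_false, Bool.false_eq_true, if_false]; omega

theorem mainTheorem3 (t : ℤ) :
    (Km t).bracket = C ((Int.negOnePow t : ℤˣ) : ℤ) * T (3 * t) ∧
      (Km t).normalizedBracket = 1 ∧
      Nonempty ((Km t).fundamentalGroup ≃* Multiplicative ℤ) := by
  refine ⟨Km_bracket t, ?_, ?_⟩
  · rw [VirtualKnotDiagram.normalizedBracket, Km_bracket, Km_writhe, mul_mul_mul_comm, ← map_mul,
      ← T_add, ← Units.val_mul, Int.units_mul_self]
    simp
  · refine VirtualKnotDiagram.fundamentalGroup_equiv fun i hi => ?_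
    rw [Km_eq] at hi ⊢
    exact meridian_eq_zero _ _ i (hi.trans_eq (length_kmWord _ _))
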